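/- Let $\lambda$ be any Young diagram (a finite set of boxes $(i,j)$, $i,j\ge 1$, containing with $(i,j)$ every box $(i',j')$ with $i'\le i$, $j'\le j$), and let $X=(X_{i,j})_{(i,j)\in\lambda}$ be independent identically distributed random variables whose common law is either geometric, $\mathbb P(X_{i,j}=m)=p(1-p)^{m-k}$ for all integers $m\ge k$, for some integer $k\ge 0$ and some $p\in(0,1)$, or exponential of some rate $\alpha>0$. A directed lattice path from $(a,b)$ to $(c,d)$ is a sequence of boxes starting at $(a,b)$ and ending at $(c,d)$, with exactly $|c-a|+|d-b|$ steps, each of which changes one of the two coordinates by $\pm1$ and leaves the other unchanged. Let $$L(a,b;c,d)=\max_{\pi:(a,b)\to(c,d)}\ \sum_{(i,j)\in\pi}X_{i,j}$$ be the maximum over all directed lattice paths $\pi$ from $(a,b)$ to $(c,d)$ (for the endpoints used here, all of them stay in $\lambda$), and for $(i,j)\in\lambda$ set $L_{i,j}=L(1,1;i,j)$ and $L^*_{i,j}=L(i,1;1,j)$. Let $\mathcal B=\{(i,j)\in\lambda : (i+1,j+1)\notin\lambda\}$ be the border strip of $\lambda$. Then the random vectors $(L_{i,j})_{(i,j)\in\mathcal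 B}$ and $(L^*_{i,j})_{(i,j)\in\mathcal B}$ have the same joint distribution. In particular, the same holds for the entries of $L$ and $L^*$ at the corners of $\lambda$, i.e. the boxes $(i,j)\in\lambda$ such that $\lambda\setminus\{(i,j)\}$ is a Young diagram. -/

import Mathlib

open MeasureTheory ProbabilityTheory

namespace LPP

/-- The lattice distance `|c - a| + |d - b|` between the boxes `(a, b)` and `(c, d)`. -/
def latticeDist (p q : ℕ × ℕ) : ℕ :=
  ((q.1 : ℤ) - p.1).natAbs + ((q.2 : ℤ) - p.2).natAbs

/-- `IsDirectedPath p q π`: the list of boxes `π` is a directed lattice path from `p` to `q`. It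
starts at `p`, ends at `q`, each step goes from a box to a box at lattice distance one, and the
number of steps is minimal, namely `latticeDist p q` (so there is one box more than that). -/
structure IsDirectedPath (p q : ℕ × ℕ) (π : List (ℕ × ℕ)) : Prop where
  head : π.head? = some p
  last : π.getLast? = some q
  step : π.IsChain (fun u v => latticeDist u v = 1)
  minimal : π.length = latticeDist p q + 1

/-- The total weights, with respect to the tableau `x` of shape `Y`, of the directed lattice paths
from `p` to `q` that run through boxes of `Y`. (A directed lattice path from `(1,1)` to `(i,j)`, or
from `(i,1)` to `(1,j)`, with `(i,j)` in `Y`, always does: see `mem_of_isDirectedPath`.) -/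
def pathWeights {Y : YoungDiagram} (x : Y → ℝ) (p q : ℕ × ℕ) : Set ℝ :=
  {s | ∃ π : List Y, IsDirectedPath p q (π.map Subtype.val) ∧ s = (π.map x).sum}

/-- The last passage percolation time from `p` to `q`: the maximum of the path weights. The maximum
is attained in the cases used below, see `isGreatest_lppTableau` and `isGreatest_dualTableau`. -/
noncomputable def lppTime {Y : YoungDiagram} (x : Y → ℝ) (p q : ℕ × ℕ) : ℝ :=
  sSup (pathWeights x p q)

/-- The LPP tableau `L i j = L(1,1; i,j)`. Rows and columns of a `YoungDiagram` are counted
from `0`, so that the box `(1,1)` is the pair `(0, 0)`. -/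
noncomputable def lppTableau {Y : YoungDiagram} (x : Y → ℝ) (c : Y) : ℝ :=
  lppTime x (0, 0) c.1

/-- The dual LPP tableau `L* i j = L(i,1; 1,j)`, rows and columns being counted from `0` in the
code. -/
noncomputable def dualTableau {Y : YoungDiagram} (x : Y → ℝ) (c : Y) : ℝ :=
  lppTime x (c.1.1, 0) (0, c.1.2)

/-- The border strip: the boxes `(i, j)` of `Y` such that `(i + 1, j + 1)` is not in `Y`. -/
def borderStrip (Y : YoungDiagram) : Set Y :=
  {c | (c.1.1 + 1, c.1.2 + 1) ∉ Y}

/-- The corners: the boxes of `Y` whose removal leaves a Young diagram. -/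
def corners (Y : YoungDiagram) : Set Y :=
  {c | IsLowerSet ((Y : Set (ℕ × ℕ)) \ {c.1})}

/-- The geometric distribution with support `{k, k + 1, …}` and parameter `p`, as a measure on `ℝ`:
the law of `G + k`, where `G` has Mathlib's geometric distribution on `{0, 1, …}`. -/
noncomputable def geometricLaw (k : ℕ) (p : unitInterval) : Measure ℝ :=
  (geometricMeasure p).map (fun n : ℕ => ((n + k : ℕ) : ℝ))

theorem geometricLaw_singleton (k : ℕ) {p : unitInterval} (hp : 0 < p) {m : ℕ} (hm : k ≤ m) :
    geometricLaw k p {(m : ℝ)} = ENNReal.ofReal (p * (1 - p) ^ (m - k)) := by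
  have h : (fun n : ℕ => ((n + k : ℕ) : ℝ)) ⁻¹' {(m : ℝ)} = {m - k} := by
    ext n
    simp only [Set.mem_preimage, Set.mem_singleton_iff, Nat.cast_inj]
    omega
  rw [geometricLaw, Measure.map_apply (by fun_prop) (measurableSet_singleton _), h,
    geometricMeasure_singleton hp.ne', mul_comm]

theorem latticeDist_le_of_chain {q : ℕ × ℕ} (l : List (ℕ × ℕ)) (p : ℕ × ℕ)
    (hc : (p :: l).IsChain (fun u v => latticeDist u v = 1)) (hl : (p :: l).getLast? = some q) :
    ∀ v ∈ p :: l, latticeDist p v + latticeDist v q ≤ l.length := by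
  induction l generalizing p with
  | nil =>
    simp only [List.getLast?_singleton, Option.some.injEq] at hl
    subst hl
    simp [latticeDist]
  | cons b l ih =>
    rw [List.isChain_cons_cons] at hc
    rw [List.getLast?_cons_cons] at hl
    have ih := ih b hc.2 hl
    have h1 := hc.1
    intro v hv
    rcases List.mem_cons.1 hv with rfl | hv
    · have := ih b (by simp)
      simp only [latticeDist, List.length_cons] at *
      omega
    · have := ih v hv
      simp only [latticeDist, List.length_cons] at *
      omega

/-- A directed lattice path stays in every Young diagram that contains the south-east corner
of the rectangle spanned by its endpoints. -/
theorem mem_of_isDirectedPath {Y : YoungDiagram} {p q : ℕ × ℕ} {π : List (ℕ × ℕ)}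
    (h : IsDirectedPath p q π) (hY : (max p.1 q.1, max p.2 q.2) ∈ Y) : ∀ v ∈ π, v ∈ Y := by
  obtain ⟨h1, h2, h3, h4⟩ := h
  cases π with
  | nil => simp
  | cons a l =>
    simp only [List.head?_cons, Option.some.injEq] at h1
    subst h1
    intro v hv
    have := latticeDist_le_of_chain l a h3 h2 v hv
    simp only [List.length_cons, latticeDist] at this h4
    refine Y.up_left_mem ?_ ?_ hY <;> omega

theorem exists_isDirectedPath (q : ℕ × ℕ) (n : ℕ) (p : ℕ × ℕ) (hn : latticeDist p q = n) :
    ∃ π, IsDirectedPath p q π := by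
  induction n generalizing p with
  | zero =>
    have : p = q := by
      ext <;> simp only [latticeDist] at hn <;> omega
    subst this
    exact ⟨[p], by simp, by simp, by simp, by simp [hn]⟩
  | succ n ih =>
    obtain ⟨r, hr, hrq⟩ : ∃ r, latticeDist p r = 1 ∧ latticeDist r q = n := by
      simp only [latticeDist] at hn ⊢
      by_cases h1 : p.1 < q.1
      · exact ⟨(p.1 + 1, p.2), by simp, by simp only; omega⟩
      by_cases h2 : q.1 < p.1
      · exact ⟨(p.1 - 1, p.2), by simp only; omega, by simp only; omega⟩
      by_cases h3 : p.2 < q.2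
      · exact ⟨(p.1, p.2 + 1), by simp, by simp only; omega⟩
      · exact ⟨(p.1, p.2 - 1), by simp only; omega, by simp only; omega⟩
    obtain ⟨π, h1, h2, h3, h4⟩ := ih r hrq
    cases π with
    | nil => simp at h1
    | cons a l =>
      simp only [List.head?_cons, Option.some.injEq] at h1
      subst h1
      refine ⟨p :: a :: l, by simp, by rwa [List.getLast?_cons_cons],
        List.isChain_cons_cons.2 ⟨hr, h3⟩, ?_⟩
      rw [List.length_cons, h4, hn, hrq]

theorem isGreatest_lppTime {Y : YoungDiagram} (x : Y → ℝ) (p q : ℕ × ℕ)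
    (hY : (max p.1 q.1, max p.2 q.2) ∈ Y) : IsGreatest (pathWeights x p q) (lppTime x p q) := by
  have hfin : (pathWeights x p q).Finite := by
    have : Finite Y := Y.cells.finite_toSet
    refine ((List.finite_length_eq Y (latticeDist p q + 1)).image
      (fun π => (π.map x).sum)).subset ?_
    rintro s ⟨π, hπ, rfl⟩
    exact ⟨π, by simpa using hπ.minimal, rfl⟩
  have hne : (pathWeights x p q).Nonempty := by
    obtain ⟨π, hπ⟩ := exists_isDirectedPath q _ p rfl
    have hmem := mem_of_isDirectedPath hπ hY
    lift π to List Y using hmem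
    exact ⟨_, π, hπ, rfl⟩
  exact ⟨hne.csSup_mem hfin, fun s hs => le_csSup hfin.bddAbove hs⟩

theorem isGreatest_lppTableau {Y : YoungDiagram} (x : Y → ℝ) (c : Y) :
    IsGreatest (pathWeights x (0, 0) c.1) (lppTableau x c) :=
  isGreatest_lppTime x _ _ (by simp)

theorem isGreatest_dualTableau {Y : YoungDiagram} (x : Y → ℝ) (c : Y) :
    IsGreatest (pathWeights x (c.1.1, 0) (0, c.1.2)) (dualTableau x c) :=
  isGreatest_lppTime x _ _ (by simp)

end LPP

/-! Both tableaux are read off two maps on fillings of the diagram, RSK and Burge, which have the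
same effect on the law of the environment. Each is built by adding the boxes of the diagram one at a
time; adding a box changes only the entries on its diagonal, by one of two piecewise linear rules.

Three facts hold for both maps. They preserve Lebesgue or counting measure, being composed of shears
and reflections of single coordinates (`exists_rskStep`, `exists_burgeStep`). A filling is
nonnegative iff its image is nonnegative with rows and columns weakly increasing
(`RSKStep.cone_iff`, `BurgeStep.cone_iff`). On nonnegative fillings, the diagonal sums of the image
at the border are rectangle sums of the environment (`SumInv.add`), so the sum of all weights is the
same function `total` of the image in both cases. An i.i.d. exponential or geometric environment has
a density depending only on nonnegativity and on the sum of the weights, so both images have the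
same law (`map_pi_eq`).

It remains to identify border entries. For RSK the corner rule is the recursion of last passage
times (`LppInv.add`). For Burge, the diagonals ending at the border are the values of lines obtained
by inserting the rows successively (`LinesInv.add`). By the commutation `pass_pass`, passing through
the lines is the same as passing through the original rows in reversed order, so the top line is the
dual passage time (`lines_top`, `dualTableau_eq_lines`).

The maps live on an ordered group `G`, taken to be ℝ or ℤ, and a monotone homomorphism carries the
result to ℝ. A geometric law supported on `m ≥ k` reduces to `k = 0` because all directed paths
between two given boxes have equal length. -/

namespace LPP

/-! ### Passage through rows, and the commutation relation behind the Burge lines -/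

section Lines

variable {G : Type*} [AddCommGroup G] [LinearOrder G]

/-- Last passage times along a row with cumulative weights `z`, started from the boundary
profile `g`. Columns are counted from `1`, and column `0` is the zero boundary. -/
def pass (z g : ℕ → G) : ℕ → G
  | 0 => 0
  | j + 1 => max (pass z g j) (g (j + 1)) + (z (j + 1) - z j)

/-- Successive passage through the rows `V 0, …, V (m - 1)`. -/
def passAll (V : ℕ → ℕ → G) : ℕ → (ℕ → G) → ℕ → G
  | 0, g => g
  | m + 1, g => pass (V m) (passAll V m g)

/-- Successive passage through the rows `V (m - 1), …, V 0`. -/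
def passDown (V : ℕ → ℕ → G) : ℕ → (ℕ → G) → ℕ → G
  | 0, g => g
  | m + 1, g => passDown V m (pass (V m) g)

/-- The Burge lines of the first `m` rows of an environment with cumulative rows `X`; line
`m - 1` is the top one. -/
def lines (X : ℕ → ℕ → G) : ℕ → ℕ → ℕ → G
  | 0, _ => fun _ => 0
  | m + 1, a => fun j =>
    if a < m then passAll (lines X m) a (X m) j + lines X m a j
      - passAll (lines X m) (a + 1) (X m) j
    else if a = m then passAll (lines X m) m (X m) j else 0

@[simp] theorem pass_zero (z g : ℕ → G) : pass z g 0 = 0 := rfl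

theorem pass_succ (z g : ℕ → G) (j : ℕ) :
    pass z g (j + 1) = max (pass z g j) (g (j + 1)) + (z (j + 1) - z j) := rfl

theorem passAll_succ (V : ℕ → ℕ → G) (m : ℕ) (g : ℕ → G) :
    passAll V (m + 1) g = pass (V m) (passAll V m g) := rfl

theorem passAll_apply_zero (V : ℕ → ℕ → G) (m : ℕ) {g : ℕ → G} (hg : g 0 = 0) :
    passAll V m g 0 = 0 := by
  cases m with
  | zero => exact hg
  | succ m => rfl

theorem lines_of_lt (X : ℕ → ℕ → G) {m a : ℕ} (h : a < m) (j : ℕ) :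
    lines X (m + 1) a j = passAll (lines X m) a (X m) j + lines X m a j
      - passAll (lines X m) (a + 1) (X m) j := by
  simp [lines, h]

theorem lines_self (X : ℕ → ℕ → G) (m : ℕ) :
    lines X (m + 1) m = passAll (lines X m) m (X m) := by
  funext j; simp [lines]

theorem lines_apply_zero (X : ℕ → ℕ → G) (hX : ∀ i, X i 0 = 0) (m a : ℕ) :
    lines X m a 0 = 0 := by
  induction m generalizing a with
  | zero => rfl
  | succ m ih =>
    rcases lt_trichotomy a m with h | rfl | h
    · simp [lines_of_lt X h, passAll_apply_zero, hX, ih]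
    · rw [lines_self, passAll_apply_zero _ _ (hX a)]
    · simp [lines, h.not_gt, h.ne']

/-- Conservation of increments when a row crosses line `a`; this becomes the recursion of `carry`.
-/
theorem passAll_succ_sub (X : ℕ → ℕ → G) {m a : ℕ} (h : a < m) (j : ℕ) :
    passAll (lines X m) (a + 1) (X m) (j + 1) - passAll (lines X m) (a + 1) (X m) j
      = lines X (m + 1) a j + lines X m a (j + 1)
        + (passAll (lines X m) a (X m) (j + 1) - passAll (lines X m) a (X m) j)
        - lines X m a j - lines X (m + 1) a (j + 1) := by
  rw [lines_of_lt X h, lines_of_lt X h]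
  abel

variable [IsOrderedAddMonoid G]

/-- One column of `pass_pass`. Here `u` and `z` are increments, `a` and `h` are the values after the
first and second passage, `b` is the value after the first passage in the swapped order, and `s` is
`pass z u j - u j`. The second conclusion is the hypothesis `ha` for the next column. -/
theorem pass_pass_aux {a b h s g u z : G} (ha : a = max (h - s) b) :
    max h (max a g + u) + z = max h (max b g + min u s) + (z + max (u - s) 0) ∧
    max a g + u = max (max h (max a g + u) + z - (z + max (s - u) 0)) (max b g + min u s) := by
  subst ha
  constructor
  · rcases le_total u s with hu | hu
    · rw [min_eq_left hu, max_eq_right (sub_nonpos.2 hu)]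
      have : h - s + u ≤ h := by
        have := add_le_add_right hu (h - s); simpa using this
      rw [← max_add_add_right, ← max_add_add_right, ← max_add_add_right, ← max_add_add_right]
      grind
    · rw [min_eq_right hu, max_eq_left (sub_nonneg.2 hu)]
      grind
  · rw [show ∀ x w : G, x + z - (z + w) = x - w from fun x w => by abel]
    rcases le_total u s with hu | hu
    · rw [min_eq_left hu, max_eq_left (sub_nonneg.2 hu)]
      have h0 : 0 ≤ s - u := sub_nonneg.2 hu
      have h1 : h - (s - u) = h - s + u := by abel
      rw [← max_sub_sub_right, h1]
      have : max (max (h - s) b) g + u - (s - u) ≤ max (max (h - s) b) g + u := sub_le_self _ h0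
      grind
    · rw [min_eq_right hu, max_eq_right (sub_nonpos.2 hu), sub_zero]
      have h1 : h ≤ max (max (h - s) b) g + u := by
        calc h = h - s + s := by abel
          _ ≤ _ := add_le_add ((le_max_left _ _).trans (le_max_left _ _)) hu
      have h2 : max b g + s ≤ max (max (h - s) b) g + u :=
        add_le_add (max_le_max_right _ (le_max_right _ _)) hu
      rw [max_eq_right h1, max_eq_left h2]

/-- Passing through the rows `u` and `z` amounts to passing through the rows
`u + z - pass z u` and `pass z u`. -/
theorem pass_pass {u z : ℕ → G} (hu : u 0 = 0) (g : ℕ → G) :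
    pass z (pass u g) = pass (pass z u) (pass (u + z - pass z u) g) := by
  -- The identity alone is not inductive: the recursion also uses the intermediate value `pass u g
  -- j`, which must be recovered from the swapped order.
  suffices H : ∀ j, pass z (pass u g) j = pass (pass z u) (pass (u + z - pass z u) g) j ∧
      pass u g j = max (pass z (pass u g) j - (pass z u j - u j))
        (pass (u + z - pass z u) g j) from funext fun j => (H j).1
  intro j
  induction j with
  | zero => simp [hu]
  | succ j ih =>
    obtain ⟨ih1, ih2⟩ := ih
    have key := pass_pass_aux (g := g (j + 1)) (u := u (j + 1) - u j) (z := z (j + 1) - z j) ih2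
    have h1 : pass z u (j + 1) - pass z u j
        = z (j + 1) - z j + max (u (j + 1) - u j - (pass z u j - u j)) 0 := by
      rw [pass_succ]; grind
    have h2 : (u + z - pass z u) (j + 1) - (u + z - pass z u) j
        = min (u (j + 1) - u j) (pass z u j - u j) := by
      simp only [Pi.add_apply, Pi.sub_apply, pass_succ]; grind
    have h3 : pass z u (j + 1) - u (j + 1)
        = z (j + 1) - z j + max (pass z u j - u j - (u (j + 1) - u j)) 0 := by
      rw [pass_succ]; grind
    constructor
    · rw [pass_succ, pass_succ u, pass_succ (pass z u), pass_succ (u + z - pass z u), h1, h2,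
        ← ih1]
      exact key.1
    · rw [pass_succ z, pass_succ u g, pass_succ (u + z - pass z u), h2, h3]
      exact key.2

/-- The new row is commuted past the old lines one at a time by `pass_pass`; each exchange leaves
the updated line behind, and what emerges at the end is the new top line. -/
theorem passAll_lines_succ {X : ℕ → ℕ → G} (hX : ∀ i, X i 0 = 0) (m : ℕ) (g : ℕ → G) :
    passAll (lines X (m + 1)) (m + 1) g = passAll (lines X m) m (pass (X m) g) := by
  have H : ∀ a ≤ m, passAll (lines X m) a (pass (X m) g)
      = pass (passAll (lines X m) a (X m)) (passAll (lines X (m + 1)) a g) := by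
    intro a
    induction a with
    | zero => intro _; rfl
    | succ a ih =>
      intro ha
      have hl : lines X (m + 1) a = passAll (lines X m) a (X m) + lines X m a
          - pass (lines X m a) (passAll (lines X m) a (X m)) :=
        funext fun j => lines_of_lt X ha j
      rw [passAll_succ, ih (by omega), pass_pass (passAll_apply_zero _ _ (hX m)), ← hl]
      rfl
  rw [H m le_rfl, passAll_succ, lines_self]

theorem passAll_lines {X : ℕ → ℕ → G} (hX : ∀ i, X i 0 = 0) (m : ℕ) (g : ℕ → G) :
    passAll (lines X m) m g = passDown X m g := by
  induction m generalizing g with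
  | zero => rfl
  | succ m ih => rw [passAll_lines_succ hX, ih]; rfl

/-- The top Burge line is the last passage time through the rows in reversed order. -/
theorem lines_top {X : ℕ → ℕ → G} (hX : ∀ i, X i 0 = 0) (m : ℕ) :
    lines X (m + 1) m = passDown X m (X m) := by
  rw [lines_self, passAll_lines hX]

theorem pass_monotone {u z : ℕ → G} (hz : Monotone z) (hu0 : u 0 = 0) :
    Monotone (pass z u) ∧ (∀ j, u j ≤ pass z u j) ∧
      (Monotone u → Monotone (u + z - pass z u)) := by
  have h1 : ∀ j, u j ≤ pass z u j := by
    intro j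
    cases j with
    | zero => simp [hu0]
    | succ j =>
      rw [pass_succ]
      exact (le_max_right _ _).trans (le_add_of_nonneg_right (sub_nonneg.2 (hz (by omega))))
  refine ⟨monotone_nat_of_le_succ fun j => ?_, h1, fun hu => monotone_nat_of_le_succ fun j => ?_⟩
  · rw [pass_succ]
    exact (le_max_left _ _).trans (le_add_of_nonneg_right (sub_nonneg.2 (hz (by omega))))
  · have := hu (Nat.le_succ j)
    have := h1 j
    simp only [Pi.add_apply, Pi.sub_apply, pass_succ, Nat.succ_eq_add_one] at *
    grind

theorem passAll_monotone {V : ℕ → ℕ → G} (hV : ∀ a, Monotone (V a)) 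
    {g : ℕ → G} (hg : Monotone g) (hg0 : g 0 = 0) (m : ℕ) : Monotone (passAll V m g) := by
  cases m with
  | zero => exact hg
  | succ m => exact (pass_monotone (hV m) (passAll_apply_zero V m hg0)).1

theorem lines_monotone {X : ℕ → ℕ → G} (hX : ∀ i, X i 0 = 0) (hm : ∀ i, Monotone (X i))
    (m a : ℕ) : Monotone (lines X m a) := by
  induction m generalizing a with
  | zero => exact fun _ _ _ => le_rfl
  | succ m ih =>
    have hW := passAll_monotone ih (hm m) (hX m)
    rcases lt_trichotomy a m with h | rfl | h
    · have := (pass_monotone (ih a)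
        (passAll_apply_zero (lines X m) a (hX m))).2.2 (hW a)
      convert this using 1
      exact funext fun j => lines_of_lt X h j
    · rw [lines_self]; exact hW a
    · have : lines X (m + 1) a = fun _ => 0 := by
        funext j; simp [lines, h.not_gt, h.ne']
      rw [this]; exact monotone_const

/-- Line `a` of `m` rows vanishes to the left of column `m - a`. -/
theorem lines_eq_zero {X : ℕ → ℕ → G} (hX : ∀ i, X i 0 = 0) (hm : ∀ i, Monotone (X i))
    {m a j : ℕ} (h : j + a < m) : lines X m a j = 0 := by
  induction m generalizing a j with
  | zero => rfl
  | succ m ih =>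
    cases j with
    | zero => exact lines_apply_zero X hX _ _
    | succ j =>
      have ha : a < m := by omega
      rw [lines_of_lt X ha, passAll_succ, pass_succ]
      -- Where the line vanishes, passing along it only takes running maxima, which does nothing to
      -- a monotone profile.
      have hz : ∀ i ≤ j, pass (lines X m a) (passAll (lines X m) a (X m)) i
          = passAll (lines X m) a (X m) i := by
        have hW := passAll_monotone (lines_monotone hX hm m) (hm m)
          (hX m) a
        intro i
        induction i with
        | zero => intro _; rw [pass_zero, passAll_apply_zero _ _ (hX m)]
        | succ i ihi =>
          intro hi
          rw [pass_succ, ihi (by omega), ih (a := a) (j := i + 1) (by omega),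
            ih (a := a) (j := i) (by omega), max_eq_right (hW (Nat.le_succ i))]
          simp
      have hW := passAll_monotone (lines_monotone hX hm m) (hm m)
          (hX m) a
      rw [hz j le_rfl, max_eq_right (hW (Nat.le_succ j)), ih (a := a) (j := j) (by omega)]
      abel

/-- The local Burge rule for the lines. -/
theorem lines_succ_eq_min (X : ℕ → ℕ → G) {m a : ℕ} (h : a < m) (j : ℕ) :
    lines X (m + 1) a (j + 1) = min (lines X (m + 1) a j
      + (passAll (lines X m) a (X m) (j + 1) - passAll (lines X m) a (X m) j))
      (lines X m a j) := by
  rw [lines_of_lt X h, lines_of_lt X h, passAll_succ, pass_succ]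
  grind

end Lines

/-! ### Measure-preserving changes of a single coordinate -/

section Shear

variable {ι G : Type*} [Fintype ι] [DecidableEq ι] [MeasurableSpace G]
  (ν : Measure G) [SigmaFinite ν]

theorem lintegral_pi_eq_of_update {f g : (ι → G) → ENNReal} (hf : Measurable f)
    (hg : Measurable g) (p : ι)
    (h : ∀ y, ∫⁻ v, f (Function.update y p v) ∂ν = ∫⁻ v, g (Function.update y p v) ∂ν) :
    ∫⁻ y, f y ∂Measure.pi (fun _ => ν) = ∫⁻ y, g y ∂Measure.pi (fun _ => ν) := by
  rcases isEmpty_or_nonempty (ι → G) with _ | ⟨⟨x⟩⟩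
  · simp
  rw [lintegral_eq_lmarginal_univ x, lintegral_eq_lmarginal_univ x,
    lmarginal_erase' _ hf (Finset.mem_univ p), lmarginal_erase' _ hg (Finset.mem_univ p)]
  simp_rw [h]

/-- By Fubini, coordinate `p` is integrated first; since `σ t y` ignores the entry of `y` at `p`,
the map is then a measure-preserving map in one variable. -/
theorem measurePreserving_update {p : ι} {σ : G → (ι → G) → G}
    (hσ : Measurable fun y : ι → G => σ (y p) y)
    (hp : ∀ t y v, σ t (Function.update y p v) = σ t y)
    (hpres : ∀ y, ∀ f : G → ENNReal, ∫⁻ v, f (σ v y) ∂ν = ∫⁻ v, f v ∂ν) :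
    MeasurePreserving (fun y => Function.update y p (σ (y p) y)) (Measure.pi fun _ => ν)
      (Measure.pi fun _ => ν) := by
  have hm : Measurable fun y : ι → G => Function.update y p (σ (y p) y) := by
    refine measurable_pi_iff.2 fun q => ?_
    by_cases hq : q = p
    · subst hq; simpa using hσ
    · simpa [hq] using measurable_pi_apply q
  refine ⟨hm, Measure.ext fun s hs => ?_⟩
  rw [Measure.map_apply hm hs, ← lintegral_indicator_one (hm hs), ← lintegral_indicator_one hs]
  refine lintegral_pi_eq_of_update ν (measurable_one.indicator (hm hs))
    (measurable_one.indicator hs) p fun y => ?_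
  refine Eq.trans (lintegral_congr fun v => ?_)
    (hpres y fun v => s.indicator 1 (Function.update y p v))
  change s.indicator 1 (Function.update (Function.update y p v) p
    (σ (Function.update y p v p) (Function.update y p v))) = _
  rw [Function.update_self, Function.update_idem, hp]

variable [AddCommGroup G] [MeasurableAdd₂ G]
  [ν.IsAddLeftInvariant]

theorem measurePreserving_shear {p : ι} {f : (ι → G) → G} (hf : Measurable f)
    (hp : ∀ y v, f (Function.update y p v) = f y) :
    MeasurePreserving (fun y => Function.update y p (f y + y p)) (Measure.pi fun _ => ν)
      (Measure.pi fun _ => ν) :=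
  measurePreserving_update ν (σ := fun t y => f y + t) (by fun_prop) (by simp [hp])
    fun y g => lintegral_add_left_eq_self g (f y)

theorem measurePreserving_reflect [MeasurableNeg G] [ν.IsNegInvariant] {p : ι} {f : (ι → G) → G}
    (hf : Measurable f) (hp : ∀ y v, f (Function.update y p v) = f y) :
    MeasurePreserving (fun y => Function.update y p (f y - y p)) (Measure.pi fun _ => ν)
      (Measure.pi fun _ => ν) := by
  have : (fun y : ι → G => Function.update y p (f y - y p))
      = fun y => Function.update y p (f y + -y p) := by simp only [sub_eq_add_neg]
  rw [this]
  exact measurePreserving_update ν (σ := fun t y => f y + -t) (by fun_prop) (by simp [hp])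
    fun y g => (lintegral_neg_eq_self fun v => g (f y + v)).trans
      (lintegral_add_left_eq_self g (f y))

end Shear

/-! ### Tableaux with a zero boundary -/

section Ext

instance (Y : YoungDiagram) : Fintype Y := Fintype.subtype Y.cells fun _ => Iff.rfl

variable {Y : YoungDiagram} {G : Type*} [Zero G]

/-- The extension of a tableau by zero, with rows and columns counted from `1`, so that row `0`
and column `0` are a zero boundary. -/
def ext (y : Y → G) : ℕ → ℕ → G
  | a + 1, b + 1 => if h : (a, b) ∈ Y then y ⟨(a, b), h⟩ else 0
  | 0, _ => 0
  | _ + 1, 0 => 0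

@[simp] theorem ext_zero_left (y : Y → G) (b : ℕ) : ext y 0 b = 0 := rfl

@[simp] theorem ext_zero_right (y : Y → G) (a : ℕ) : ext y a 0 = 0 := by cases a <;> rfl

theorem ext_cell (y : Y → G) (p : Y) : ext y (p.1.1 + 1) (p.1.2 + 1) = y p := by
  have h : (p.1.1, p.1.2) ∈ Y := p.2
  simp [ext, h]

theorem ext_mem (y : Y → G) {a b : ℕ} (h : (a, b) ∈ Y) :
    ext y (a + 1) (b + 1) = y ⟨(a, b), h⟩ := by
  simp [ext, h]

theorem ext_of_notMem (y : Y → G) {a b : ℕ} (h : (a, b) ∉ Y) : ext y (a + 1) (b + 1) = 0 := by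
  simp [ext, h]

theorem ext_congr {y y' : Y → G} {I J : ℕ}
    (h : ∀ p : Y, p.1.1 + 1 = I → p.1.2 + 1 = J → y p = y' p) : ext y I J = ext y' I J := by
  rcases I with _ | a
  · simp
  rcases J with _ | b
  · simp
  by_cases hm : (a, b) ∈ Y
  · rw [ext_mem _ hm, ext_mem _ hm, h _ rfl rfl]
  · rw [ext_of_notMem _ hm, ext_of_notMem _ hm]

theorem ext_update [DecidableEq Y] (y : Y → G) {p : Y} (v : G) {I J : ℕ}
    (h : ¬(I = p.1.1 + 1 ∧ J = p.1.2 + 1)) : ext (Function.update y p v) I J = ext y I J := by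
  refine ext_congr fun q h1 h2 => Function.update_of_ne ?_ _ _
  rintro rfl
  exact h ⟨h1.symm, h2.symm⟩

@[fun_prop]
theorem measurable_ext [MeasurableSpace G] (I J : ℕ) :
    Measurable fun y : Y → G => ext y I J := by
  rcases I with _ | a
  · simp
  rcases J with _ | b
  · simp
  by_cases hm : (a, b) ∈ Y
  · simp only [ext_mem _ hm]; fun_prop
  · simp only [ext_of_notMem _ hm]; fun_prop

end Ext

/-! ### The local RSK and Burge moves preserve measure -/

section Steps

variable {Y : YoungDiagram} {G : Type*} [AddCommGroup G] [LinearOrder G]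

/-- The carry of the Burge rule along the diagonal that starts at the box `(a, b)`. -/
def carry (f : ℕ → ℕ → G) (u : G) (a b : ℕ) : ℕ → G
  | 0 => u + f a (b + 1)
  | n + 1 => f (a + n + 1) (b + n) + f (a + n + 1) (b + n + 2) + carry f u a b n
      - f (a + n + 1) (b + n + 1)
      - min (f (a + n + 1) (b + n) + carry f u a b n) (f (a + n + 1) (b + n + 1))

/-- `f` and `f'` agree off the diagonal segment from `(a, b)` to `(a + K, b + K)`. -/
def AgreeOff (a b K : ℕ) (f f' : ℕ → ℕ → G) : Prop :=
  ∀ I J, (∀ n ≤ K, ¬(I = a + n + 1 ∧ J = b + n + 1)) → f' I J = f I J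

/-- The local RSK rule at the box `(a + K, b + K)`, where `(a, b)` is the first box of its
diagonal. -/
structure RSKStep (a b K : ℕ) (f f' : ℕ → ℕ → G) : Prop where
  off : AgreeOff a b K f f'
  diag : ∀ n < K, f' (a + n + 1) (b + n + 1)
    = max (f (a + n) (b + n + 1)) (f (a + n + 1) (b + n))
      + min (f (a + n + 1) (b + n + 2)) (f (a + n + 2) (b + n + 1)) - f (a + n + 1) (b + n + 1)
  corner : f' (a + K + 1) (b + K + 1)
    = max (f (a + K) (b + K + 1)) (f (a + K + 1) (b + K)) + f (a + K + 1) (b + K + 1)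

/-- The local Burge rule at the box `(a + K, b + K)`, where `(a, b)` is the first box of its
diagonal. -/
structure BurgeStep (a b K : ℕ) (f f' : ℕ → ℕ → G) : Prop where
  off : AgreeOff a b K f f'
  diag : ∀ n < K, f' (a + n + 1) (b + n + 1)
    = min (f (a + n + 1) (b + n) + carry f (f (a + K + 1) (b + K + 1)) a b n)
        (f (a + n + 1) (b + n + 1))
  corner : f' (a + K + 1) (b + K + 1)
    = f (a + K + 1) (b + K) + carry f (f (a + K + 1) (b + K + 1)) a b K

variable [MeasurableSpace G] [MeasurableAdd₂ G] [MeasurableInf₂ G]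
  (ν : Measure G) [SigmaFinite ν] [ν.IsAddLeftInvariant]

/-- The four neighbours of a box lie on the adjacent diagonals, which do not change. So the boxes of
the diagonal can be updated one by one: a reflection at each inner box, and a shear at the corner.
-/
theorem exists_rskStep [MeasurableNeg G] [MeasurableSup₂ G] [ν.IsNegInvariant] {a b K : ℕ}
    (hY : (a + K, b + K) ∈ Y) :
    ∃ T : (Y → G) → Y → G, MeasurePreserving T (Measure.pi fun _ => ν) (Measure.pi fun _ => ν) ∧
      ∀ y, RSKStep a b K (ext y) (ext (T y)) := by
  classical
  have hmem : ∀ n ≤ K, (a + n, b + n) ∈ Y := fun n hn =>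
    Y.up_left_mem (by omega) (by omega) hY
  have H : ∀ N ≤ K, ∃ T : (Y → G) → Y → G,
      MeasurePreserving T (Measure.pi fun _ => ν) (Measure.pi fun _ => ν) ∧
      ∀ y, (∀ I J, (∀ n < N, ¬(I = a + n + 1 ∧ J = b + n + 1)) → ext (T y) I J = ext y I J) ∧
      ∀ n < N, ext (T y) (a + n + 1) (b + n + 1)
        = max (ext y (a + n) (b + n + 1)) (ext y (a + n + 1) (b + n))
          + min (ext y (a + n + 1) (b + n + 2)) (ext y (a + n + 2) (b + n + 1))
          - ext y (a + n + 1) (b + n + 1) := by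
    intro N
    induction N with
    | zero => exact fun _ => ⟨id, MeasurePreserving.id _, fun y => ⟨fun _ _ _ => rfl, by simp⟩⟩
    | succ N ih =>
      intro hN
      obtain ⟨T, hT, h⟩ := ih (by omega)
      have hS := measurePreserving_reflect ν (p := (⟨_, hmem N (by omega)⟩ : Y))
        (f := fun y => max (ext y (a + N) (b + N + 1)) (ext y (a + N + 1) (b + N))
          + min (ext y (a + N + 1) (b + N + 2)) (ext y (a + N + 2) (b + N + 1)))
        (by fun_prop) (fun y v => by
          rw [ext_update, ext_update, ext_update, ext_update] <;> dsimp only <;> omega)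
      refine ⟨_, hS.comp hT, fun y => ⟨fun I J hIJ => ?_, fun n hn => ?_⟩⟩
      · simp only [Function.comp_apply]
        rw [ext_update _ _ (hIJ N (by omega)), (h y).1 _ _ fun n hn => hIJ n (by omega)]
      · simp only [Function.comp_apply]
        rcases Nat.lt_succ_iff_lt_or_eq.1 hn with hn | rfl
        · rw [ext_update _ _ (by dsimp only; omega), (h y).2 n hn]
        · rw [ext_mem _ (hmem n (by omega)), Function.update_self, ← ext_mem (T y) (hmem n (by omega)),
            (h y).1 _ _ (by omega), (h y).1 _ _ (by omega), (h y).1 _ _ (by omega),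
            (h y).1 _ _ (by omega), (h y).1 _ _ (by omega)]
  obtain ⟨T, hT, h⟩ := H K le_rfl
  have hS := measurePreserving_shear ν (p := (⟨_, hY⟩ : Y))
    (f := fun y => max (ext y (a + K) (b + K + 1)) (ext y (a + K + 1) (b + K)))
    (by fun_prop) (fun y v => by
      rw [ext_update, ext_update] <;> dsimp only <;> omega)
  refine ⟨_, hS.comp hT, fun y => ⟨fun I J hIJ => ?_, fun n hn => ?_, ?_⟩⟩
  · simp only [Function.comp_apply]
    rw [ext_update _ _ (hIJ K le_rfl), (h y).1 _ _ fun n hn => hIJ n hn.le]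
  · simp only [Function.comp_apply]
    rw [ext_update _ _ (by dsimp only; omega), (h y).2 n hn]
  · simp only [Function.comp_apply]
    rw [ext_mem _ hY, Function.update_self, ← ext_mem (T y) hY,
      (h y).1 _ _ (by omega), (h y).1 _ _ (by omega), (h y).1 _ _ (by omega)]

/-- The corner box serves as a register for the carry `v`. With `l`, `r`, `ρ` the left, right and
diagonal entries, one step is three shears: the register becomes `v + l - ρ`; adding its minimum
with `0` to `ρ` gives `ρ' = min (l + v) ρ`; adding `r - ρ'` to the register gives the next carry. -/
theorem exists_burgeStep [IsOrderedAddMonoid G] [MeasurableSub₂ G] {a b K : ℕ} (hY : (a + K, b + K) ∈ Y) :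
    ∃ T : (Y → G) → Y → G, MeasurePreserving T (Measure.pi fun _ => ν) (Measure.pi fun _ => ν) ∧
      ∀ y, BurgeStep a b K (ext y) (ext (T y)) := by
  classical
  have hmem : ∀ n ≤ K, (a + n, b + n) ∈ Y := fun n hn =>
    Y.up_left_mem (by omega) (by omega) hY
  have H : ∀ N ≤ K, ∃ T : (Y → G) → Y → G,
      MeasurePreserving T (Measure.pi fun _ => ν) (Measure.pi fun _ => ν) ∧
      ∀ y, (∀ I J, ¬(I = a + K + 1 ∧ J = b + K + 1) →
        (∀ n < N, ¬(I = a + n + 1 ∧ J = b + n + 1)) → ext (T y) I J = ext y I J) ∧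
      (∀ n < N, ext (T y) (a + n + 1) (b + n + 1)
        = min (ext y (a + n + 1) (b + n)
            + carry (ext y) (ext y (a + K + 1) (b + K + 1)) a b n)
          (ext y (a + n + 1) (b + n + 1))) ∧
      ext (T y) (a + K + 1) (b + K + 1)
        = carry (ext y) (ext y (a + K + 1) (b + K + 1)) a b N := by
    intro N
    induction N with
    | zero =>
      intro _
      have hS := measurePreserving_shear ν (p := (⟨_, hY⟩ : Y))
        (f := fun y => ext y a (b + 1)) (by fun_prop)
        (fun y v => ext_update _ _ (by dsimp only; omega))
      refine ⟨_, hS, fun y => ⟨fun I J hIJ _ => ext_update _ _ hIJ, by simp, ?_⟩⟩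
      rw [ext_mem _ hY, Function.update_self, ← ext_mem y hY, add_comm]; rfl
    | succ N ih =>
      intro hN
      obtain ⟨T, hT, h⟩ := ih (by omega)
      have hN' := hmem N (by omega)
      have hS1 := measurePreserving_shear ν (p := (⟨_, hY⟩ : Y))
        (f := fun y => ext y (a + N + 1) (b + N) - ext y (a + N + 1) (b + N + 1))
        (by fun_prop) (fun y v => by
          rw [ext_update, ext_update] <;> dsimp only <;> omega)
      have hS2 := measurePreserving_shear ν (p := (⟨_, hN'⟩ : Y))
        (f := fun y => min (ext y (a + K + 1) (b + K + 1)) 0)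
        (by fun_prop) (fun y v => by
          rw [ext_update]; dsimp only; omega)
      have hS3 := measurePreserving_shear ν (p := (⟨_, hY⟩ : Y))
        (f := fun y => ext y (a + N + 1) (b + N + 2) - ext y (a + N + 1) (b + N + 1))
        (by fun_prop) (fun y v => by
          rw [ext_update, ext_update] <;> dsimp only <;> omega)
      refine ⟨_, hS3.comp (hS2.comp (hS1.comp hT)), fun y => ?_⟩
      obtain ⟨h1, h2, h3⟩ := h y
      have hne : ¬(a + N + 1 = a + K + 1 ∧ b + N + 1 = b + K + 1) := by omega
      have hne' : ¬(a + K + 1 = a + N + 1 ∧ b + K + 1 = b + N + 1) := by omega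
      have e1 : ext (T y) (a + N + 1) (b + N + 1) = ext y (a + N + 1) (b + N + 1) :=
        h1 _ _ hne (by omega)
      have e2 : ext (T y) (a + N + 1) (b + N) = ext y (a + N + 1) (b + N) :=
        h1 _ _ (by omega) (by omega)
      have e3 : ext (T y) (a + N + 1) (b + N + 2) = ext y (a + N + 1) (b + N + 2) :=
        h1 _ _ (by omega) (by omega)
      generalize hw1 : Function.update (T y) (⟨_, hY⟩ : Y)
        (ext (T y) (a + N + 1) (b + N) - ext (T y) (a + N + 1) (b + N + 1) + T y ⟨_, hY⟩) = w1
      have w1c : ext w1 (a + K + 1) (b + K + 1) = ext y (a + N + 1) (b + N)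
          - ext y (a + N + 1) (b + N + 1)
          + carry (ext y) (ext y (a + K + 1) (b + K + 1)) a b N := by
        rw [ext_mem _ hY, ← hw1, Function.update_self, ← ext_mem (T y) hY, e1, e2, h3]
      have w1o : ∀ I J, ¬(I = a + K + 1 ∧ J = b + K + 1) → ext w1 I J = ext (T y) I J := by
        intro I J hIJ; rw [← hw1]; exact ext_update _ _ hIJ
      generalize hw2 : Function.update w1 (⟨_, hN'⟩ : Y)
        (min (ext w1 (a + K + 1) (b + K + 1)) 0 + w1 ⟨_, hN'⟩) = w2
      have w2d : ext w2 (a + N + 1) (b + N + 1) = min (ext y (a + N + 1) (b + N)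
            + carry (ext y) (ext y (a + K + 1) (b + K + 1)) a b N)
          (ext y (a + N + 1) (b + N + 1)) := by
        rw [ext_mem _ hN', ← hw2, Function.update_self, ← ext_mem w1 hN', w1c, w1o _ _ hne, e1]
        rw [← min_add_add_right, zero_add, sub_add_eq_add_sub, sub_add_cancel]
      have w2o : ∀ I J, ¬(I = a + N + 1 ∧ J = b + N + 1) → ext w2 I J = ext w1 I J := by
        intro I J hIJ; rw [← hw2]; exact ext_update _ _ hIJ
      generalize hw3 : Function.update w2 (⟨_, hY⟩ : Y)
        (ext w2 (a + N + 1) (b + N + 2) - ext w2 (a + N + 1) (b + N + 1) + w2 ⟨_, hY⟩) = w3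
      have w3c : ext w3 (a + K + 1) (b + K + 1)
          = carry (ext y) (ext y (a + K + 1) (b + K + 1)) a b (N + 1) := by
        rw [ext_mem _ hY, ← hw3, Function.update_self, ← ext_mem w2 hY, w2d, w2o _ _ (by omega),
          w1o _ _ (by omega), e3, w2o _ _ hne', w1c, carry]
        abel
      have w3o : ∀ I J, ¬(I = a + K + 1 ∧ J = b + K + 1) → ext w3 I J = ext w2 I J := by
        intro I J hIJ; rw [← hw3]; exact ext_update _ _ hIJ
      have hw : ((fun w : Y → G => Function.update w (⟨_, hY⟩ : Y)
          (ext w (a + N + 1) (b + N + 2) - ext w (a + N + 1) (b + N + 1) + w ⟨_, hY⟩)) ∘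
          (fun w : Y → G => Function.update w (⟨_, hN'⟩ : Y)
            (min (ext w (a + K + 1) (b + K + 1)) 0 + w ⟨_, hN'⟩)) ∘
          (fun w : Y → G => Function.update w (⟨_, hY⟩ : Y)
            (ext w (a + N + 1) (b + N) - ext w (a + N + 1) (b + N + 1) + w ⟨_, hY⟩)) ∘ T) y
          = w3 := by
        simp only [Function.comp_apply, hw1, hw2, hw3]
      rw [hw]
      refine ⟨fun I J hIJ hd => ?_, fun n hn => ?_, w3c⟩
      · rw [w3o _ _ hIJ, w2o _ _ (hd N (by omega)), w1o _ _ hIJ,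
          h1 _ _ hIJ fun n hn => hd n (by omega)]
      · rw [w3o _ _ (by omega)]
        rcases Nat.lt_succ_iff_lt_or_eq.1 hn with hn | rfl
        · rw [w2o _ _ (by omega), w1o _ _ (by omega), h2 n hn]
        · exact w2d
  obtain ⟨T, hT, h⟩ := H K le_rfl
  have hS := measurePreserving_shear ν (p := (⟨_, hY⟩ : Y))
    (f := fun y => ext y (a + K + 1) (b + K))
    (by fun_prop) (fun y v => by
      rw [ext_update]; dsimp only; omega)
  refine ⟨_, hS.comp hT, fun y => ⟨fun I J hIJ => ?_, fun n hn => ?_, ?_⟩⟩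
  · simp only [Function.comp_apply]
    rw [ext_update _ _ (hIJ K le_rfl), (h y).1 _ _ (hIJ K le_rfl) fun n hn => hIJ n hn.le]
  · simp only [Function.comp_apply]
    rw [ext_update _ _ (by dsimp only; omega), (h y).2.1 n hn]
  · simp only [Function.comp_apply]
    rw [ext_mem _ hY, Function.update_self, ← ext_mem (T y) hY, (h y).2.2,
      (h y).1 _ _ (by omega) (by omega)]

end Steps

/-! ### The local moves match the interlacing conditions -/

section Cone

theorem AgreeOff.symm {G : Type*} {a b K : ℕ} {f f' : ℕ → ℕ → G} (h : AgreeOff a b K f f') :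
    AgreeOff a b K f' f := fun I J hIJ => (h I J hIJ).symm

variable {G : Type*} [AddCommGroup G] [LinearOrder G]

/-- `S'` is obtained from `S` by adding the box `(a + K, b + K)`, whose diagonal starts at
`(a, b)`. -/
structure IsAddBox (S S' : YoungDiagram) (a b K : ℕ) : Prop where
  start : a = 0 ∨ b = 0
  notMem : (a + K, b + K) ∉ S
  mem_iff : ∀ p, p ∈ S' ↔ p = (a + K, b + K) ∨ p ∈ S

theorem IsAddBox.mem_of_le {S S' : YoungDiagram} {a b K : ℕ} (h : IsAddBox S S' a b K) {i j : ℕ}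
    (hi : i ≤ a + K) (hj : j ≤ b + K) (hne : i < a + K ∨ j < b + K) : (i, j) ∈ S := by
  have : (i, j) ∈ S' := S'.up_left_mem hi hj ((h.mem_iff _).2 (Or.inl rfl))
  refine ((h.mem_iff _).1 this).resolve_left fun h => ?_
  simp only [Prod.mk.injEq] at h
  omega

theorem IsAddBox.notMem_of_ge {S S' : YoungDiagram} {a b K : ℕ} (h : IsAddBox S S' a b K)
    {i j : ℕ} (hi : a + K ≤ i) (hj : b + K ≤ j) : (i, j) ∉ S :=
  fun hm => h.notMem (S.up_left_mem hi hj hm)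

theorem IsAddBox.notMem_of_gt {S S' : YoungDiagram} {a b K : ℕ} (h : IsAddBox S S' a b K)
    {i j : ℕ} (hi : a + K ≤ i) (hj : b + K ≤ j) (hne : a + K < i ∨ b + K < j) :
    (i, j) ∉ S' := by
  intro hm
  rcases (h.mem_iff _).1 hm with h' | h'
  · simp only [Prod.mk.injEq] at h'
    omega
  · exact h.notMem_of_ge hi hj h'

/-- The nonnegative tableaux that are interlacing on `S`. -/
structure Cone (S : YoungDiagram) (f : ℕ → ℕ → G) : Prop where
  nonneg : ∀ I J, 0 ≤ f I J
  up : ∀ i j, (i, j) ∈ S → f i (j + 1) ≤ f (i + 1) (j + 1)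
  left : ∀ i j, (i, j) ∈ S → f (i + 1) j ≤ f (i + 1) (j + 1)

/-- Every interlacing inequality compares adjacent diagonals, so only those with one end on the
changed diagonal need checking. -/
theorem Cone.transfer {a b K : ℕ} {f f' : ℕ → ℕ → G} (hoff : AgreeOff a b K f f')
    {T₁ T₂ : YoungDiagram} (hT : ∀ p, p ≠ (a + K, b + K) → p ∈ T₂ → p ∈ T₁) (h : Cone T₁ f)
    (hlow : ∀ n ≤ K, (a + n, b + n) ∈ T₂ → f (a + n) (b + n + 1) ≤ f' (a + n + 1) (b + n + 1) ∧
      f (a + n + 1) (b + n) ≤ f' (a + n + 1) (b + n + 1))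
    (hup : ∀ n < K, f' (a + n + 1) (b + n + 1) ≤ f (a + n + 1) (b + n + 2) ∧
      f' (a + n + 1) (b + n + 1) ≤ f (a + n + 2) (b + n + 1))
    (h0 : ∀ n ≤ K, 0 ≤ f' (a + n + 1) (b + n + 1))
    (hK₁ : (a + K + 1, b + K) ∉ T₂) (hK₂ : (a + K, b + K + 1) ∉ T₂) : Cone T₂ f' := by
  refine ⟨fun I J => ?_, fun i j hij => ?_, fun i j hij => ?_⟩
  · by_cases hd : ∃ n ≤ K, I = a + n + 1 ∧ J = b + n + 1
    · obtain ⟨n, hn, rfl, rfl⟩ := hd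
      exact h0 n hn
    · push Not at hd
      rw [hoff I J fun n hn h => hd n hn h.1 h.2]
      exact h.nonneg I J
  · by_cases hd : ∃ n ≤ K, i = a + n ∧ j = b + n
    · obtain ⟨n, hn, rfl, rfl⟩ := hd
      rw [hoff (a + n) _ (by omega)]
      exact (hlow n hn hij).1
    · push Not at hd
      rw [hoff (i + 1) (j + 1) fun n hn h => hd n hn (by omega) (by omega)]
      by_cases hd' : ∃ n ≤ K, i = a + n + 1 ∧ j = b + n
      · obtain ⟨n, hn, rfl, rfl⟩ := hd'
        rcases hn.lt_or_eq with hn | rfl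
        · exact (hup n hn).2
        · exact absurd hij hK₁
      · push Not at hd'
        rw [hoff i (j + 1) fun n hn h => hd' n hn (by omega) (by omega)]
        refine h.up i j (hT _ (fun h => ?_) hij)
        simp only [Prod.mk.injEq] at h
        exact hd K le_rfl h.1 h.2
  · by_cases hd : ∃ n ≤ K, i = a + n ∧ j = b + n
    · obtain ⟨n, hn, rfl, rfl⟩ := hd
      rw [hoff _ (b + n) (by omega)]
      exact (hlow n hn hij).2
    · push Not at hd
      rw [hoff (i + 1) (j + 1) fun n hn h => hd n hn (by omega) (by omega)]
      by_cases hd' : ∃ n ≤ K, i = a + n ∧ j = b + n + 1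
      · obtain ⟨n, hn, rfl, rfl⟩ := hd'
        rcases hn.lt_or_eq with hn | rfl
        · exact (hup n hn).1
        · exact absurd hij hK₂
      · push Not at hd'
        rw [hoff (i + 1) j fun n hn h => hd' n hn (by omega) (by omega)]
        refine h.left i j (hT _ (fun h => ?_) hij)
        simp only [Prod.mk.injEq] at h
        exact hd K le_rfl h.1 h.2

variable {S S' : YoungDiagram} {a b K : ℕ} {f f' : ℕ → ℕ → G}

theorem Cone.diag_bounds (h : Cone S f) (hS : IsAddBox S S' a b K) {n : ℕ} (hn : n < K) :
    f (a + n) (b + n + 1) ≤ f (a + n + 1) (b + n + 1) ∧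
    f (a + n + 1) (b + n) ≤ f (a + n + 1) (b + n + 1) ∧
    f (a + n + 1) (b + n + 1) ≤ f (a + n + 1) (b + n + 2) ∧
    f (a + n + 1) (b + n + 1) ≤ f (a + n + 2) (b + n + 1) :=
  ⟨h.up _ _ (hS.mem_of_le (by omega) (by omega) (by omega)),
    h.left _ _ (hS.mem_of_le (by omega) (by omega) (by omega)),
    h.left _ (b + n + 1) (hS.mem_of_le (by omega) (by omega) (by omega)),
    h.up (a + n + 1) _ (hS.mem_of_le (by omega) (by omega) (by omega))⟩

theorem Cone.diag_bounds' (h : Cone S' f') (hS : IsAddBox S S' a b K)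
    (hoff : AgreeOff a b K f f') {n : ℕ} (hn : n < K) :
    f (a + n) (b + n + 1) ≤ f' (a + n + 1) (b + n + 1) ∧
    f (a + n + 1) (b + n) ≤ f' (a + n + 1) (b + n + 1) ∧
    f' (a + n + 1) (b + n + 1) ≤ f (a + n + 1) (b + n + 2) ∧
    f' (a + n + 1) (b + n + 1) ≤ f (a + n + 2) (b + n + 1) := by
  have H : ∀ {i j}, i ≤ a + K → j ≤ b + K → (i, j) ∈ S' := fun hi hj =>
    S'.up_left_mem hi hj ((hS.mem_iff _).2 (Or.inl rfl))
  rw [← hoff (a + n) _ (by omega), ← hoff (a + n + 1) (b + n) (by omega),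
    ← hoff (a + n + 1) (b + n + 2) (by omega), ← hoff (a + n + 2) _ (by omega)]
  exact ⟨h.up _ _ (H (by omega) (by omega)), h.left _ _ (H (by omega) (by omega)),
    h.left _ (b + n + 1) (H (by omega) (by omega)), h.up (a + n + 1) _ (H (by omega) (by omega))⟩

theorem Cone.corner_bounds' (h : Cone S' f') (hS : IsAddBox S S' a b K)
    (hoff : AgreeOff a b K f f') :
    f (a + K) (b + K + 1) ≤ f' (a + K + 1) (b + K + 1) ∧
    f (a + K + 1) (b + K) ≤ f' (a + K + 1) (b + K + 1) := by
  have hc : (a + K, b + K) ∈ S' := (hS.mem_iff _).2 (Or.inl rfl)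
  rw [← hoff (a + K) _ (by omega), ← hoff (a + K + 1) (b + K) (by omega)]
  exact ⟨h.up _ _ hc, h.left _ _ hc⟩

/-- The forward transfer of the cone condition reduces to the changed diagonal. -/
theorem Cone.add (h : Cone S f) (hS : IsAddBox S S' a b K) (hoff : AgreeOff a b K f f')
    (hlow : ∀ n ≤ K, f (a + n) (b + n + 1) ≤ f' (a + n + 1) (b + n + 1) ∧
      f (a + n + 1) (b + n) ≤ f' (a + n + 1) (b + n + 1))
    (hup : ∀ n < K, f' (a + n + 1) (b + n + 1) ≤ f (a + n + 1) (b + n + 2) ∧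
      f' (a + n + 1) (b + n + 1) ≤ f (a + n + 2) (b + n + 1)) : Cone S' f' :=
  h.transfer hoff (fun _ hp hm => ((hS.mem_iff _).1 hm).resolve_left hp)
    (fun n hn _ => hlow n hn) hup (fun n hn => (h.nonneg _ _).trans (hlow n hn).1)
    (hS.notMem_of_gt (by omega) (by omega) (by omega))
    (hS.notMem_of_gt (by omega) (by omega) (by omega))

/-- The backward transfer of the cone condition reduces to the changed diagonal. -/
theorem Cone.remove (h : Cone S' f') (hS : IsAddBox S S' a b K) (hoff : AgreeOff a b K f f')
    (hlow : ∀ n < K, f (a + n) (b + n + 1) ≤ f (a + n + 1) (b + n + 1) ∧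
      f (a + n + 1) (b + n) ≤ f (a + n + 1) (b + n + 1))
    (hup : ∀ n < K, f (a + n + 1) (b + n + 1) ≤ f (a + n + 1) (b + n + 2) ∧
      f (a + n + 1) (b + n + 1) ≤ f (a + n + 2) (b + n + 1))
    (h0 : 0 ≤ f (a + K + 1) (b + K + 1)) : Cone S f := by
  have e1 : ∀ n, f' (a + n) (b + n + 1) = f (a + n) (b + n + 1) := fun n =>
    hoff _ _ (by omega)
  have e2 : ∀ n, f' (a + n + 1) (b + n) = f (a + n + 1) (b + n) := fun n =>
    hoff _ _ (by omega)
  have e3 : ∀ n, f' (a + n + 1) (b + n + 2) = f (a + n + 1) (b + n + 2) := fun n =>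
    hoff _ _ (by omega)
  have e4 : ∀ n, f' (a + n + 2) (b + n + 1) = f (a + n + 2) (b + n + 1) := fun n =>
    hoff _ _ (by omega)
  refine h.transfer hoff.symm (fun p _ hm => (hS.mem_iff _).2 (Or.inr hm)) (fun n hn hm => ?_)
    (fun n hn => ?_) (fun n hn => ?_)
    (hS.notMem_of_ge (by omega) (by omega)) (hS.notMem_of_ge (by omega) (by omega))
  · rcases hn.lt_or_eq with hn | rfl
    · rw [e1, e2]
      exact hlow n hn
    · exact absurd hm hS.notMem
  · rw [e3, e4]
    exact hup n hn
  · rcases hn.lt_or_eq with hn | rfl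
    · refine le_trans ?_ (hlow n hn).1
      rw [← e1]
      exact h.nonneg _ _
    · exact h0

variable [IsOrderedAddMonoid G]

theorem RSKStep.cone_iff (hS : IsAddBox S S' a b K) (h : RSKStep a b K f f') :
    Cone S' f' ↔ Cone S f := by
  -- The inner RSK rule is the reflection of the interval from `M` to `m`: it exchanges the lower
  -- and the upper bound on the diagonal entry.
  have key : ∀ M m ρ : G, (M + m - ρ ≤ m ↔ M ≤ ρ) ∧ (M ≤ M + m - ρ ↔ ρ ≤ m) := by
    intro M m ρ
    constructor
    · rw [add_sub_right_comm, add_le_iff_nonpos_left, sub_nonpos]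
    · rw [add_sub_assoc, le_add_iff_nonneg_right, sub_nonneg]
  constructor
  · intro hc
    have hb := fun n (hn : n < K) => hc.diag_bounds' hS h.off hn
    have hk : max (f (a + K) (b + K + 1)) (f (a + K + 1) (b + K))
        ≤ f' (a + K + 1) (b + K + 1) := max_le_iff.2 (hc.corner_bounds' hS h.off)
    refine hc.remove hS h.off (fun n hn => ?_) (fun n hn => ?_) ?_
    · obtain ⟨-, -, h3, h4⟩ := hb n hn
      have h3 := le_min h3 h4
      rw [h.diag n hn, (key _ _ _).1] at h3
      exact max_le_iff.1 h3
    · obtain ⟨h1, h2, -, -⟩ := hb n hn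
      have h3 := max_le h1 h2
      rw [h.diag n hn, (key _ _ _).2] at h3
      exact le_min_iff.1 h3
    · rw [h.corner] at hk
      exact (le_add_iff_nonneg_right _).1 hk
  · intro hc
    have hb := fun n (hn : n < K) => hc.diag_bounds hS hn
    refine hc.add hS h.off (fun n hn => max_le_iff.1 ?_) (fun n hn => le_min_iff.1 ?_)
    · rcases hn.lt_or_eq with hn | rfl
      · obtain ⟨-, -, h3, h4⟩ := hb n hn
        rw [h.diag n hn, (key _ _ _).2]
        exact le_min h3 h4
      · rw [h.corner]
        exact le_add_of_nonneg_right (hc.nonneg _ _)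
    · obtain ⟨h1, h2, -, -⟩ := hb n hn
      rw [h.diag n hn, (key _ _ _).1]
      exact max_le h1 h2

/-- The invariant along the diagonal is `0 ≤ v` and `u ≤ l + v` for the carry `v`. The entries `r`
and `d` are the upper and left neighbours of the next box, so the last two conclusions are the
invariant there. -/
theorem burge_forward {l u r d ρ v : G} (h1 : u ≤ ρ) (h2 : l ≤ ρ) (h3 : ρ ≤ r) (h4 : ρ ≤ d)
    (h5 : 0 ≤ v) (h6 : u ≤ l + v) :
    (u ≤ min (l + v) ρ ∧ l ≤ min (l + v) ρ ∧ min (l + v) ρ ≤ r ∧ min (l + v) ρ ≤ d) ∧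
      0 ≤ l + r + v - ρ - min (l + v) ρ ∧ r ≤ d + (l + r + v - ρ - min (l + v) ρ) := by
  grind

theorem burge_backward {l u r d ρ v : G} (h1 : u ≤ min (l + v) ρ) (h2 : l ≤ min (l + v) ρ)
    (h3 : min (l + v) ρ ≤ r) (h4 : min (l + v) ρ ≤ d)
    (h5 : 0 ≤ l + r + v - ρ - min (l + v) ρ)
    (h6 : r ≤ d + (l + r + v - ρ - min (l + v) ρ)) :
    (u ≤ ρ ∧ l ≤ ρ ∧ ρ ≤ r ∧ ρ ≤ d) ∧ 0 ≤ v ∧ u ≤ l + v := by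
  grind

theorem BurgeStep.cone_iff (hS : IsAddBox S S' a b K) (hl : ∀ I, f I 0 = 0)
    (hu : ∀ J, f 0 J = 0) (h : BurgeStep a b K f f') : Cone S' f' ↔ Cone S f := by
  constructor
  · intro hc
    have hb := fun n (hn : n < K) => hc.diag_bounds' hS h.off hn
    obtain ⟨hk1, hk2⟩ := hc.corner_bounds' hS h.off
    rw [h.corner] at hk1 hk2
    -- Descending induction along the diagonal, with `m = K - n`: the corner bounds give the
    -- invariant at `K`, and `burge_backward` moves it towards the boundary.
    have H : ∀ m n, n + m = K →
        0 ≤ carry f (f (a + K + 1) (b + K + 1)) a b n ∧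
        f (a + n) (b + n + 1)
          ≤ f (a + n + 1) (b + n) + carry f (f (a + K + 1) (b + K + 1)) a b n := by
      intro m
      induction m with
      | zero => rintro n rfl; exact ⟨(le_add_iff_nonneg_right _).1 hk2, hk1⟩
      | succ m ih =>
        intro n hn
        obtain ⟨i1, i2⟩ := ih (n + 1) (by omega)
        obtain ⟨h1, h2, h3, h4⟩ := hb n (by omega)
        rw [h.diag n (by omega)] at h1 h2 h3 h4
        exact (burge_backward h1 h2 h3 h4 i1 i2).2
    have hρ : ∀ n < K, _ := fun n hn => by
      obtain ⟨i1, i2⟩ := H (K - (n + 1)) (n + 1) (by omega)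
      obtain ⟨h1, h2, h3, h4⟩ := hb n hn
      rw [h.diag n hn] at h1 h2 h3 h4
      exact (burge_backward h1 h2 h3 h4 i1 i2).1
    refine hc.remove hS h.off (fun n hn => ⟨(hρ n hn).1, (hρ n hn).2.1⟩)
      (fun n hn => (hρ n hn).2.2) ?_
    obtain ⟨h1, h2⟩ := H K 0 (by omega)
    simp only [carry, add_zero] at h1 h2
    -- The initial carry is the new weight plus the entry above the first box. In the first row that
    -- entry is zero; in the first column the left neighbour is zero and the entry above cancels.
    rcases hS.start with rfl | rfl
    · simpa [hu] using h1
    · rw [hl, zero_add, zero_add] at h2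
      exact (le_add_iff_nonneg_left _).1 h2
  · intro hc
    have hb := fun n (hn : n < K) => hc.diag_bounds hS hn
    have H : ∀ n ≤ K, 0 ≤ carry f (f (a + K + 1) (b + K + 1)) a b n ∧
        f (a + n) (b + n + 1)
          ≤ f (a + n + 1) (b + n) + carry f (f (a + K + 1) (b + K + 1)) a b n := by
      intro n
      induction n with
      | zero =>
        intro _
        have h0 := hc.nonneg (a + K + 1) (b + K + 1)
        have h1 := hc.nonneg a (b + 1)
        have h2 := hc.nonneg (a + 1) b
        simp only [carry, add_zero]
        exact ⟨add_nonneg h0 h1, by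
          rw [← add_assoc]; exact le_add_of_nonneg_left (add_nonneg h2 h0)⟩
      | succ n ih =>
        intro hn
        obtain ⟨i1, i2⟩ := ih (by omega)
        obtain ⟨h1, h2, h3, h4⟩ := hb n (by omega)
        exact (burge_forward h1 h2 h3 h4 i1 i2).2
    have hκ : ∀ n < K, _ := fun n hn => by
      obtain ⟨i1, i2⟩ := H n hn.le
      obtain ⟨h1, h2, h3, h4⟩ := hb n hn
      have := (burge_forward h1 h2 h3 h4 i1 i2).1
      rwa [← h.diag n hn] at this
    refine hc.add hS h.off (fun n hn => ?_) (fun n hn => (hκ n hn).2.2)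
    rcases hn.lt_or_eq with hn | rfl
    · exact ⟨(hκ n hn).1, (hκ n hn).2.1⟩
    · rw [h.corner]
      exact ⟨(H n le_rfl).2, le_add_of_nonneg_right (H n le_rfl).1⟩

end Cone

/-! ### Diagonal sums -/

section Invariants

variable {G : Type*} [AddCommGroup G]

/-- The sum of the entries of `f` on the part of the diagonal up to `(I, J)`. -/
def diagSum (f : ℕ → ℕ → G) : ℕ → ℕ → G
  | a + 1, b + 1 => f (a + 1) (b + 1) + diagSum f a b
  | 0, _ => 0
  | _ + 1, 0 => 0

@[simp] theorem diagSum_zero_left (f : ℕ → ℕ → G) (b : ℕ) : diagSum f 0 b = 0 := by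
  cases b <;> rfl

@[simp] theorem diagSum_zero_right (f : ℕ → ℕ → G) (a : ℕ) : diagSum f a 0 = 0 := by
  cases a <;> rfl

theorem diagSum_succ (f : ℕ → ℕ → G) (a b : ℕ) :
    diagSum f (a + 1) (b + 1) = f (a + 1) (b + 1) + diagSum f a b := rfl

theorem diagSum_congr {f f' : ℕ → ℕ → G} {I J : ℕ}
    (h : ∀ i j m, i + m = I → j + m = J → f' i j = f i j) : diagSum f' I J = diagSum f I J := by
  induction I generalizing J with
  | zero => simp
  | succ I ih =>
    cases J with
    | zero => simp
    | succ J =>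
      rw [diagSum_succ, diagSum_succ, h _ _ 0 rfl rfl,
        ih fun i j m h1 h2 => h i j (m + 1) (by omega) (by omega)]

/-- The sum of the entries of `X` in the rectangle with opposite corners `(1, 1)`, `(I, J)`. -/
def rectSum (X : ℕ → ℕ → G) (I J : ℕ) : G :=
  ∑ i ∈ Finset.range I, ∑ j ∈ Finset.range J, X (i + 1) (j + 1)

theorem rectSum_succ_succ (X : ℕ → ℕ → G) (I J : ℕ) :
    rectSum X (I + 1) (J + 1) + rectSum X I J
      = rectSum X I (J + 1) + rectSum X (I + 1) J + X (I + 1) (J + 1) := by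
  simp only [rectSum, Finset.sum_range_succ]
  abel

variable {S S' : YoungDiagram} {a b K : ℕ} {f f' : ℕ → ℕ → G}

theorem diagSum_start_up (hs : a = 0 ∨ b = 0) (hu : ∀ J, f 0 J = 0) :
    diagSum f a (b + 1) = f a (b + 1) := by
  rcases a with _ | a
  · simp [hu]
  · obtain rfl : b = 0 := by omega
    simp [diagSum_succ]

theorem diagSum_start_left (hs : a = 0 ∨ b = 0) (hl : ∀ I, f I 0 = 0) :
    diagSum f (a + 1) b = f (a + 1) b := by
  rcases b with _ | b
  · simp [hl]
  · obtain rfl : a = 0 := by omega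
    simp [diagSum_succ]

theorem diagSum_start (hs : a = 0 ∨ b = 0) : diagSum f a b = 0 := by
  rcases hs with rfl | rfl <;> simp

/-- Summing the rule along the diagonal, the minimum from one box and the maximum from the next
involve the same two entries and add up to their sum. Nonnegativity serves at the start, where one
of the two entries is on the zero boundary. -/
theorem RSKStep.diagSum_add [LinearOrder G] [IsOrderedAddMonoid G] (hs : a = 0 ∨ b = 0)
    (hl : ∀ I, f I 0 = 0) (hu : ∀ J, f 0 J = 0) (h0 : ∀ I J, 0 ≤ f I J)
    (h : RSKStep a b K f f') :
    diagSum f' (a + K + 1) (b + K + 1) + diagSum f (a + K) (b + K)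
      = diagSum f (a + K) (b + K + 1) + diagSum f (a + K + 1) (b + K)
        + f (a + K + 1) (b + K + 1) := by
  have H : ∀ N ≤ K, diagSum f' (a + N) (b + N) + diagSum f (a + N) (b + N)
      + max (f (a + N) (b + N + 1)) (f (a + N + 1) (b + N))
      = diagSum f (a + N) (b + N + 1) + diagSum f (a + N + 1) (b + N) := by
    intro N
    induction N with
    | zero =>
      intro _
      simp only [add_zero]
      rw [diagSum_start_up hs hu, diagSum_start_left hs hl, diagSum_start hs, diagSum_start hs,
        zero_add, zero_add]
      have h1 := h0 a (b + 1)
      have h2 := h0 (a + 1) b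
      rcases hs with rfl | rfl
      · simp [hu, h2]
      · simp [hl, h1]
    | succ N ih =>
      intro hN
      have ih := ih (by omega)
      have hd := h.diag N (by omega)
      have hm := min_add_max (f (a + N + 1) (b + N + 2)) (f (a + N + 2) (b + N + 1))
      change f' (a + N + 1) (b + N + 1) + diagSum f' (a + N) (b + N)
        + (f (a + N + 1) (b + N + 1) + diagSum f (a + N) (b + N))
        + max (f (a + N + 1) (b + N + 2)) (f (a + N + 2) (b + N + 1))
        = f (a + N + 1) (b + N + 2) + diagSum f (a + N) (b + N + 1)
          + (f (a + N + 2) (b + N + 1) + diagSum f (a + N + 1) (b + N))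
      rw [hd]
      calc _ = (diagSum f' (a + N) (b + N) + diagSum f (a + N) (b + N)
              + max (f (a + N) (b + N + 1)) (f (a + N + 1) (b + N)))
            + (min (f (a + N + 1) (b + N + 2)) (f (a + N + 2) (b + N + 1))
              + max (f (a + N + 1) (b + N + 2)) (f (a + N + 2) (b + N + 1))) := by abel
        _ = _ := by rw [ih, hm]; abel
  have := H K le_rfl
  rw [diagSum_succ, h.corner]
  rw [← this]
  abel

/-- The balance is as for RSK, with the left entry plus the carry in the role of the maximum; here
it is built into the recursion of `carry`. -/
theorem BurgeStep.diagSum_add [LinearOrder G] (hs : a = 0 ∨ b = 0)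
    (hl : ∀ I, f I 0 = 0) (hu : ∀ J, f 0 J = 0) (h : BurgeStep a b K f f') :
    diagSum f' (a + K + 1) (b + K + 1) + diagSum f (a + K) (b + K)
      = diagSum f (a + K) (b + K + 1) + diagSum f (a + K + 1) (b + K)
        + f (a + K + 1) (b + K + 1) := by
  have H : ∀ N ≤ K, diagSum f' (a + N) (b + N) + diagSum f (a + N) (b + N)
      + (f (a + N + 1) (b + N) + carry f (f (a + K + 1) (b + K + 1)) a b N)
      = diagSum f (a + N) (b + N + 1) + diagSum f (a + N + 1) (b + N)
        + f (a + K + 1) (b + K + 1) := by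
    intro N
    induction N with
    | zero =>
      intro _
      simp only [add_zero]
      rw [diagSum_start_up hs hu, diagSum_start_left hs hl, diagSum_start hs, diagSum_start hs,
        carry]
      abel
    | succ N ih =>
      intro hN
      have ih := ih (by omega)
      have hd := h.diag N (by omega)
      change f' (a + N + 1) (b + N + 1) + diagSum f' (a + N) (b + N)
        + (f (a + N + 1) (b + N + 1) + diagSum f (a + N) (b + N))
        + (f (a + N + 2) (b + N + 1) + (f (a + N + 1) (b + N) + f (a + N + 1) (b + N + 2)
          + carry f (f (a + K + 1) (b + K + 1)) a b N - f (a + N + 1) (b + N + 1)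
          - min (f (a + N + 1) (b + N) + carry f (f (a + K + 1) (b + K + 1)) a b N)
            (f (a + N + 1) (b + N + 1))))
        = f (a + N + 1) (b + N + 2) + diagSum f (a + N) (b + N + 1)
          + (f (a + N + 2) (b + N + 1) + diagSum f (a + N + 1) (b + N))
          + f (a + K + 1) (b + K + 1)
      rw [hd]
      calc _ = (diagSum f' (a + N) (b + N) + diagSum f (a + N) (b + N)
              + (f (a + N + 1) (b + N) + carry f (f (a + K + 1) (b + K + 1)) a b N))
            + (f (a + N + 2) (b + N + 1) + f (a + N + 1) (b + N + 2)) := by abel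
        _ = _ := by rw [ih]; abel
  have := H K le_rfl
  rw [diagSum_succ, h.corner]
  rw [← this]
  abel

end Invariants

/-! ### How the border changes when a box is added -/

section Border

/-- In coordinates counted from `1`, with the boundary row and column `0` included: the boxes
`(I, J)` of `S` whose south-east neighbour is not in `S`. -/
def IsBorder (S : YoungDiagram) (I J : ℕ) : Prop :=
  (I = 0 ∨ J = 0 ∨ (I - 1, J - 1) ∈ S) ∧ (I, J) ∉ S

variable {S S' : YoungDiagram} {a b K : ℕ}

/-- Apart from the new box and the zero boundary, border positions are old ones, and the part of the
diagonal leading up to them avoids the changed segment; so invariants need checking only at the new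
box. -/
theorem IsAddBox.isBorder_cases (hS : IsAddBox S S' a b K) {I J : ℕ} (h : IsBorder S' I J) :
    (I = a + K + 1 ∧ J = b + K + 1) ∨ I = 0 ∨ J = 0 ∨
      (IsBorder S I J ∧ ∀ n ≤ K, ∀ m, ¬(I = a + n + 1 + m ∧ J = b + n + 1 + m)) := by
  obtain ⟨h1, h2⟩ := h
  by_cases hI : I = 0
  · exact Or.inr (Or.inl hI)
  by_cases hJ : J = 0
  · exact Or.inr (Or.inr (Or.inl hJ))
  by_cases hc : I = a + K + 1 ∧ J = b + K + 1
  · exact Or.inl hc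
  refine Or.inr (Or.inr (Or.inr ?_))
  have hm : (I - 1, J - 1) ∈ S := by
    refine ((hS.mem_iff _).1 ((h1.resolve_left hI).resolve_left hJ)).resolve_left fun h => hc ?_
    simp only [Prod.mk.injEq] at h
    omega
  refine ⟨⟨Or.inr (Or.inr hm), fun h => h2 ((hS.mem_iff _).2 (Or.inr h))⟩, ?_⟩
  rintro n hn m ⟨rfl, rfl⟩
  rcases le_or_gt K (n + m) with hK | hK
  · exact hS.notMem_of_ge (by omega) (by omega) hm
  · exact h2 (S'.up_left_mem (by omega) (by omega) ((hS.mem_iff _).2 (Or.inl rfl)))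

theorem IsAddBox.isBorder_up (hS : IsAddBox S S' a b K) : IsBorder S (a + K) (b + K + 1) := by
  refine ⟨?_, hS.notMem_of_ge (by omega) (by omega)⟩
  rcases Nat.eq_zero_or_pos (a + K) with h | h
  · exact Or.inl h
  · exact Or.inr (Or.inr (hS.mem_of_le (by omega) (by omega) (by omega)))

theorem IsAddBox.isBorder_left (hS : IsAddBox S S' a b K) : IsBorder S (a + K + 1) (b + K) := by
  refine ⟨?_, hS.notMem_of_ge (by omega) (by omega)⟩
  rcases Nat.eq_zero_or_pos (b + K) with h | h
  · exact Or.inr (Or.inl h)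
  · exact Or.inr (Or.inr (hS.mem_of_le (by omega) (by omega) (by omega)))

theorem IsAddBox.isBorder_diag (hS : IsAddBox S S' a b K) : IsBorder S (a + K) (b + K) := by
  refine ⟨?_, hS.notMem⟩
  rcases Nat.eq_zero_or_pos (a + K) with h | h
  · exact Or.inl h
  rcases Nat.eq_zero_or_pos (b + K) with h' | h'
  · exact Or.inr (Or.inl h')
  · exact Or.inr (Or.inr (hS.mem_of_le (by omega) (by omega) (by omega)))

end Border

/-! ### Invariants of the box-by-box construction -/

section Invariants

variable {G : Type*} [AddCommGroup G] {S S' : YoungDiagram} {a b K : ℕ}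
  {X f f' : ℕ → ℕ → G}

/-- The cumulative rows of an environment. -/
def cumRow (X : ℕ → ℕ → G) (i J : ℕ) : G := ∑ j ∈ Finset.range J, X (i + 1) (j + 1)

/-- The state `f` comes from the environment `X` by processing the boxes of `S`: the boxes
outside of `S` are untouched, and the diagonal sums at the border are rectangle sums. -/
structure SumInv (S : YoungDiagram) (X f : ℕ → ℕ → G) : Prop where
  untouched : ∀ i j, (i, j) ∉ S → f (i + 1) (j + 1) = X (i + 1) (j + 1)
  diagSum_eq : ∀ I J, IsBorder S I J → diagSum f I J = rectSum X I J

/-- The hypothesis `hsum` is inclusion–exclusion, the recursion that rectangle sums satisfy by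
`rectSum_succ_succ`. -/
theorem SumInv.add (h : SumInv S X f) (hS : IsAddBox S S' a b K) (hoff : AgreeOff a b K f f')
    (hsum : diagSum f' (a + K + 1) (b + K + 1) + diagSum f (a + K) (b + K)
      = diagSum f (a + K) (b + K + 1) + diagSum f (a + K + 1) (b + K)
        + f (a + K + 1) (b + K + 1)) : SumInv S' X f' := by
  refine ⟨fun i j hij => ?_, fun I J hIJ => ?_⟩
  · rw [hoff, h.untouched i j fun hm => hij ((hS.mem_iff _).2 (Or.inr hm))]
    intro n hn hh
    exact hij (S'.up_left_mem (by omega) (by omega) ((hS.mem_iff _).2 (Or.inl rfl)))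
  · rcases hS.isBorder_cases hIJ with ⟨rfl, rfl⟩ | rfl | rfl | ⟨hb, hd⟩
    · have hr := rectSum_succ_succ X (a + K) (b + K)
      rw [h.diagSum_eq _ _ hS.isBorder_up, h.diagSum_eq _ _ hS.isBorder_left,
        h.diagSum_eq _ _ hS.isBorder_diag, h.untouched _ _ hS.notMem, ← hr] at hsum
      exact add_right_cancel hsum
    · simp [rectSum]
    · simp [rectSum]
    · rw [← h.diagSum_eq _ _ hb]
      refine diagSum_congr fun i j m hi hj => hoff _ _ fun n hn hh => hd n hn m ?_
      omega

theorem sumInv_bot (f : ℕ → ℕ → G) : SumInv ⊥ f f := by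
  refine ⟨fun _ _ _ => rfl, fun I J h => ?_⟩
  rcases h.1 with rfl | rfl | h
  · simp [rectSum]
  · simp [rectSum]
  · simp at h

variable [LinearOrder G]

/-- The last passage times from the box `(1, 1)`, defined recursively. -/
def lppRec (X : ℕ → ℕ → G) : ℕ → ℕ → G
  | i + 1, j + 1 => max (lppRec X i (j + 1)) (lppRec X (i + 1) j) + X (i + 1) (j + 1)
  | 0, _ => 0
  | _ + 1, 0 => 0

@[simp] theorem lppRec_zero_left (X : ℕ → ℕ → G) (j : ℕ) : lppRec X 0 j = 0 := by
  cases j <;> simp [lppRec]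

@[simp] theorem lppRec_zero_right (X : ℕ → ℕ → G) (i : ℕ) : lppRec X i 0 = 0 := by
  cases i <;> simp [lppRec]

theorem lppRec_succ (X : ℕ → ℕ → G) (i j : ℕ) : lppRec X (i + 1) (j + 1)
    = max (lppRec X i (j + 1)) (lppRec X (i + 1) j) + X (i + 1) (j + 1) := by
  simp [lppRec]

/-- The border entries of the state are the last passage times. -/
def LppInv (S : YoungDiagram) (X f : ℕ → ℕ → G) : Prop :=
  ∀ I J, IsBorder S I J → f I J = lppRec X I J

theorem LppInv.add (h : LppInv S X f) (h' : SumInv S X f) (hS : IsAddBox S S' a b K)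
    (hl : ∀ I, f' I 0 = 0) (hu : ∀ J, f' 0 J = 0)
    (hstep : RSKStep a b K f f') : LppInv S' X f' := by
  intro I J hIJ
  rcases hS.isBorder_cases hIJ with ⟨rfl, rfl⟩ | rfl | rfl | ⟨hb, hd⟩
  · rw [hstep.corner, lppRec_succ, h _ _ hS.isBorder_up, h _ _ hS.isBorder_left,
      h'.untouched _ _ hS.notMem]
  · simp [hu]
  · simp [hl]
  · rw [← h _ _ hb]
    exact hstep.off _ _ fun n hn hh => hd n hn 0 hh

/-- The diagonals of the state that end at the border are the Burge lines. -/
def LinesInv (S : YoungDiagram) (X f : ℕ → ℕ → G) : Prop :=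
  ∀ I J, IsBorder S I J → ∀ i j m, i + 1 + m = I → j + 1 + m = J →
    f (i + 1) (j + 1) = lines (cumRow X) I i J

variable [IsOrderedAddMonoid G]

/-- The `n`-th carry is the increment, over the new column, of the new row after it has crossed the
first `a + n` lines. The left, right and diagonal entries are then exactly the line values in
`lines_succ_eq_min`. -/
theorem LinesInv.add (h : LinesInv S X f) (h' : SumInv S X f) (hX : ∀ I J, 0 ≤ X I J)
    (hS : IsAddBox S S' a b K) (hl : ∀ I, f I 0 = 0) (hu : ∀ J, f 0 J = 0)
    (hstep : BurgeStep a b K f f') : LinesInv S' X f' := by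
  have hc0 : ∀ i, cumRow X i 0 = 0 := fun i => by simp [cumRow]
  have hcm : ∀ i, Monotone (cumRow X i) := fun i => monotone_nat_of_le_succ fun j => by
    rw [cumRow, cumRow, Finset.sum_range_succ]
    exact le_add_of_nonneg_right (hX _ _)
  have hz : ∀ {m α j}, j + α < m → lines (cumRow X) m α j = 0 := lines_eq_zero hc0 hcm
  have hx : f (a + K + 1) (b + K + 1)
      = cumRow X (a + K) (b + K + 1) - cumRow X (a + K) (b + K) := by
    rw [h'.untouched _ _ hS.notMem, cumRow, cumRow, Finset.sum_range_succ]
    abel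
  have hleft : ∀ n ≤ K, f (a + n + 1) (b + n) = lines (cumRow X) (a + K + 1) (a + n) (b + K) := by
    intro n hn
    rcases Nat.eq_zero_or_pos (b + n) with h0 | h0
    · rw [h0, hl, hz (by omega)]
    · obtain ⟨β, hβ⟩ : ∃ β, b + n = β + 1 := ⟨b + n - 1, by omega⟩
      rw [hβ]
      exact h _ _ hS.isBorder_left (a + n) β (K - n) (by omega) (by omega)
  have hright : ∀ n < K, f (a + n + 1) (b + n + 2)
      = lines (cumRow X) (a + K) (a + n) (b + K + 1) := fun n hn =>
    h _ _ hS.isBorder_up (a + n) (b + n + 1) (K - n - 1) (by omega) (by omega)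
  have hdiag : ∀ n < K, f (a + n + 1) (b + n + 1)
      = lines (cumRow X) (a + K) (a + n) (b + K) := fun n hn =>
    h _ _ hS.isBorder_diag (a + n) (b + n) (K - n - 1) (by omega) (by omega)
  have hcarry : ∀ n ≤ K, carry f (f (a + K + 1) (b + K + 1)) a b n
      = passAll (lines (cumRow X) (a + K)) (a + n) (cumRow X (a + K)) (b + K + 1)
        - passAll (lines (cumRow X) (a + K)) (a + n) (cumRow X (a + K)) (b + K) := by
    intro n
    induction n with
    | zero =>
      intro _
      rw [carry]
      rcases a with _ | a
      · rw [hu, hx, add_zero]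
        rfl
      · obtain rfl : b = 0 := by have := hS.start; omega
        -- The diagonal starts in the first column. The lines that vanish at both columns leave the
        -- increment unchanged; the next one contributes the entry above the first box, which is why
        -- `carry` starts with that term.
        have hW : ∀ α ≤ a, passAll (lines (cumRow X) (a + 1 + K)) α (cumRow X (a + 1 + K))
              (0 + K + 1) - passAll (lines (cumRow X) (a + 1 + K)) α (cumRow X (a + 1 + K))
              (0 + K) = f (a + 1 + K + 1) (0 + K + 1) := by
          intro α
          induction α with
          | zero => intro _; rw [hx]; rfl
          | succ α ih =>
            intro hα
            rw [passAll_succ_sub _ (by omega), ih (by omega), hz (by omega), hz (by omega),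
              hz (by omega), hz (by omega)]
            abel
        rw [add_zero, passAll_succ_sub _ (by omega), hW a le_rfl, hz (by omega),
          hz (m := a + 1 + K) (j := 0 + K) (by omega), hz (m := a + 1 + K + 1) (by omega),
          h _ _ hS.isBorder_up a 0 K (by omega) (by omega)]
        abel
    | succ n ih =>
      intro hn
      rw [← add_assoc, passAll_succ_sub _ (by omega), lines_succ_eq_min _ (by omega),
        ← ih (by omega), ← hleft n (by omega), ← hright n (by omega), ← hdiag n (by omega), carry]
  intro I J hIJ i j m hi hj
  rcases hS.isBorder_cases hIJ with ⟨rfl, rfl⟩ | rfl | rfl | ⟨hb, hd⟩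
  · have hs := hS.start
    obtain ⟨n, rfl⟩ : ∃ n, i = a + n := ⟨i - a, by omega⟩
    obtain rfl : j = b + n := by omega
    rcases (show n ≤ K by omega).lt_or_eq with hn | rfl
    · rw [hstep.diag n hn, lines_succ_eq_min _ (by omega), hcarry n hn.le, hleft n hn.le,
        hdiag n hn]
    · rw [hstep.corner, hcarry _ le_rfl, hleft _ le_rfl, lines_self]
      abel
  · omega
  · omega
  · rw [← h _ _ hb i j m hi hj]
    refine hstep.off _ _ fun n hn hh => hd n hn m ?_
    omega

end Invariants

/-! ### Composing the moves over all boxes -/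

section Transform

theorem exists_isAddBox {S' : YoungDiagram} (h : S' ≠ ⊥) :
    ∃ S a b K, IsAddBox S S' a b K ∧ S.card < S'.card := by
  have hne : S'.cells.Nonempty := by
    rw [Finset.nonempty_iff_ne_empty]
    exact fun h0 => h (YoungDiagram.ext h0)
  obtain ⟨c, hc, hmax⟩ := S'.cells.exists_max_image (fun p => p.1 + p.2) hne
  have hlow : IsLowerSet ((S'.cells.erase c : Finset (ℕ × ℕ)) : Set (ℕ × ℕ)) := by
    intro p q hqp hp
    simp only [Finset.coe_erase, Set.mem_sdiff, Finset.mem_coe, Set.mem_singleton_iff] at hp ⊢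
    refine ⟨S'.isLowerSet hqp hp.1, ?_⟩
    rintro rfl
    have h1 := hmax p hp.1
    have h2 := Prod.le_def.1 hqp
    exact hp.2 (Prod.ext (by omega) (by omega))
  -- A box maximising the sum of its coordinates is removable; subtracting the smaller coordinate
  -- from both leads to the start of its diagonal.
  refine ⟨⟨S'.cells.erase c, hlow⟩, c.1 - min c.1 c.2, c.2 - min c.1 c.2, min c.1 c.2, ?_, ?_⟩
  · have hcc : (c.1 - min c.1 c.2 + min c.1 c.2, c.2 - min c.1 c.2 + min c.1 c.2) = c :=
      Prod.ext (by dsimp only; omega) (by dsimp only; omega)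
    refine ⟨by omega, ?_, fun p => ?_⟩
    · rw [hcc, ← YoungDiagram.mem_cells]
      simp
    · rw [hcc, ← YoungDiagram.mem_cells, ← YoungDiagram.mem_cells]
      by_cases hp : p = c
      · simp [hp, hc]
      · simp [hp]
  · exact Finset.card_erase_lt_of_mem hc

variable {Y : YoungDiagram} {G : Type*} [MeasurableSpace G] (ν : Measure G)

theorem exists_transform {Q : YoungDiagram → (Y → G) → (Y → G) → Prop} (h0 : ∀ x, Q ⊥ x x)
    (hstep : ∀ S S' a b K, (a + K, b + K) ∈ Y → IsAddBox S S' a b K →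
      ∃ T : (Y → G) → Y → G, MeasurePreserving T (Measure.pi fun _ => ν) (Measure.pi fun _ => ν) ∧
        ∀ x y, Q S x y → Q S' x (T y)) :
    ∃ R : (Y → G) → Y → G, MeasurePreserving R (Measure.pi fun _ => ν) (Measure.pi fun _ => ν) ∧
      ∀ x, Q Y x (R x) := by
  have H : ∀ n, ∀ S : YoungDiagram, S.card = n → S ≤ Y → ∃ R : (Y → G) → Y → G,
      MeasurePreserving R (Measure.pi fun _ => ν) (Measure.pi fun _ => ν) ∧
      ∀ x, Q S x (R x) := by
    intro n
    induction n using Nat.strong_induction_on with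
    | _ n ih =>
      intro S' hn hY
      by_cases hb : S' = ⊥
      · subst hb
        exact ⟨id, MeasurePreserving.id _, h0⟩
      · obtain ⟨S, a, b, K, hS, hcard⟩ := exists_isAddBox hb
        obtain ⟨R, hR, hQ⟩ := ih _ (hn ▸ hcard) S rfl fun p hp =>
          hY ((hS.mem_iff p).2 (Or.inr hp))
        obtain ⟨T, hT, hT'⟩ := hstep S S' a b K (hY ((hS.mem_iff _).2 (Or.inl rfl))) hS
        exact ⟨T ∘ R, hT.comp hR, fun x => hT' _ _ (hQ x)⟩
  exact H _ Y rfl le_rfl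

variable [AddCommGroup G] [LinearOrder G] [IsOrderedAddMonoid G] [MeasurableAdd₂ G]
  [MeasurableInf₂ G] [SigmaFinite ν] [ν.IsAddLeftInvariant]

variable (Y) in
theorem exists_rsk [MeasurableNeg G] [MeasurableSup₂ G] [ν.IsNegInvariant] :
    ∃ R : (Y → G) → Y → G, MeasurePreserving R (Measure.pi fun _ => ν) (Measure.pi fun _ => ν) ∧
      ∀ x, (Cone Y (ext (R x)) ↔ Cone ⊥ (ext x)) ∧ (Cone ⊥ (ext x) →
        SumInv Y (ext x) (ext (R x)) ∧ LppInv Y (ext x) (ext (R x))) := by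
  refine exists_transform ν (Q := fun S x y => (Cone S (ext y) ↔ Cone ⊥ (ext x)) ∧
    (Cone ⊥ (ext x) → SumInv S (ext x) (ext y) ∧ LppInv S (ext x) (ext y))) (fun x => ?_) ?_
  · refine ⟨Iff.rfl, fun _ => ⟨sumInv_bot _, fun I J h => ?_⟩⟩
    rcases h.1 with rfl | rfl | h
    · simp
    · simp
    · simp at h
  · intro S S' a b K hY hS
    obtain ⟨T, hT, hT'⟩ := exists_rskStep ν hY
    refine ⟨T, hT, fun x y ⟨h1, h2⟩ => ?_⟩
    have hst := hT' y
    refine ⟨(hst.cone_iff hS).trans h1, fun hc => ?_⟩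
    obtain ⟨h3, h4⟩ := h2 hc
    exact ⟨h3.add hS hst.off (hst.diagSum_add hS.start (ext_zero_right y) (ext_zero_left y)
      (h1.2 hc).nonneg), h4.add h3 hS (ext_zero_right _) (ext_zero_left _) hst⟩

variable (Y) in
theorem exists_burge [MeasurableSub₂ G] :
    ∃ R : (Y → G) → Y → G, MeasurePreserving R (Measure.pi fun _ => ν) (Measure.pi fun _ => ν) ∧
      ∀ x, (Cone Y (ext (R x)) ↔ Cone ⊥ (ext x)) ∧ (Cone ⊥ (ext x) →
        SumInv Y (ext x) (ext (R x)) ∧ LinesInv Y (ext x) (ext (R x))) := by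
  refine exists_transform ν (Q := fun S x y => (Cone S (ext y) ↔ Cone ⊥ (ext x)) ∧
    (Cone ⊥ (ext x) → SumInv S (ext x) (ext y) ∧ LinesInv S (ext x) (ext y))) (fun x => ?_) ?_
  · refine ⟨Iff.rfl, fun _ => ⟨sumInv_bot _, fun I J h => ?_⟩⟩
    rcases h.1 with rfl | rfl | h
    · intros; omega
    · intros; omega
    · simp at h
  · intro S S' a b K hY hS
    obtain ⟨T, hT, hT'⟩ := exists_burgeStep ν hY
    refine ⟨T, hT, fun x y ⟨h1, h2⟩ => ?_⟩
    have hst := hT' y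
    refine ⟨(hst.cone_iff hS (ext_zero_right y) (ext_zero_left y)).trans h1, fun hc => ?_⟩
    obtain ⟨h3, h4⟩ := h2 hc
    exact ⟨h3.add hS hst.off (hst.diagSum_add hS.start (ext_zero_right y) (ext_zero_left y)),
      h4.add h3 hc.nonneg hS (ext_zero_right _) (ext_zero_left _) hst⟩

end Transform

/-! ### Product densities and their images -/

section PiDensity

variable {ι G : Type*} [Fintype ι] [MeasurableSpace G] (ν : Measure G) [SigmaFinite ν]

theorem lintegral_pi_prod {f : ι → G → ENNReal} (hf : ∀ i, Measurable (f i)) :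
    ∫⁻ x, ∏ i, f i (x i) ∂Measure.pi (fun _ => ν) = ∏ i, ∫⁻ t, f i t ∂ν := by
  classical
  have H : ∀ (s : Finset ι) (x : ι → G), (∫⋯∫⁻_s, (fun x => ∏ i, f i (x i)) ∂fun _ => ν) x
      = (∏ i ∈ s, ∫⁻ t, f i t ∂ν) * ∏ i ∈ sᶜ, f i (x i) := by
    intro s
    induction s using Finset.induction_on with
    | empty => simp
    | insert i s hi ih =>
      intro x
      have hc : sᶜ = insert i (insert i s)ᶜ := by
        ext j
        by_cases hj : j = i <;> simp [hj, hi]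
      rw [lmarginal_insert _ (by fun_prop) hi, Finset.prod_insert hi]
      simp_rw [ih, hc]
      have hm : i ∉ (insert i s)ᶜ := by simp
      have hp : ∀ v, ∏ j ∈ insert i (insert i s)ᶜ, f j (Function.update x i v j)
          = f i v * ∏ j ∈ (insert i s)ᶜ, f j (x j) := fun v => by
        rw [Finset.prod_insert hm, Function.update_self]
        congr 1
        refine Finset.prod_congr rfl fun j hj => ?_
        rw [Function.update_of_ne (ne_of_mem_of_not_mem hj hm)]
      simp_rw [hp]
      rw [lintegral_const_mul _ (by fun_prop), lintegral_mul_const _ (hf i)]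
      ring
  rcases isEmpty_or_nonempty (ι → G) with h | ⟨⟨x⟩⟩
  · obtain ⟨i, hi⟩ := isEmpty_pi.1 h
    rw [lintegral_of_isEmpty, eq_comm]
    exact Finset.prod_eq_zero (Finset.mem_univ i) (lintegral_of_isEmpty _ _)
  · rw [lintegral_eq_lmarginal_univ x, H]
    simp

theorem pi_withDensity {h : G → ENNReal} (hh : Measurable h) [SigmaFinite (ν.withDensity h)] :
    Measure.pi (fun _ : ι => ν.withDensity h)
      = (Measure.pi fun _ => ν).withDensity fun x => ∏ i, h (x i) := by
  refine Measure.pi_eq fun s hs => ?_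
  rw [withDensity_apply _ (MeasurableSet.univ_pi hs),
    ← lintegral_indicator (MeasurableSet.univ_pi hs)]
  have h1 : ∀ x : ι → G, (Set.univ.pi s).indicator (fun x => ∏ i, h (x i)) x
      = ∏ i, (s i).indicator h (x i) := by
    intro x
    classical
    by_cases hx : x ∈ Set.univ.pi s
    · rw [Set.indicator_of_mem hx]
      exact Finset.prod_congr rfl fun i _ => (Set.indicator_of_mem (hx i trivial) _).symm
    · rw [Set.indicator_of_notMem hx]
      simp only [Set.mem_pi, Set.mem_univ, true_imp_iff, not_forall] at hx
      obtain ⟨i, hi⟩ := hx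
      exact (Finset.prod_eq_zero (Finset.mem_univ i) (Set.indicator_of_notMem hi _)).symm
  simp_rw [h1]
  rw [lintegral_pi_prod ν fun i => hh.indicator (hs i)]
  exact Finset.prod_congr rfl fun i _ => by
    rw [lintegral_indicator (hs i), withDensity_apply _ (hs i)]

/-- A change of variables without inverse: it suffices that the density factors through `R`. -/
theorem _root_.MeasureTheory.MeasurePreserving.map_withDensity_comp {α β : Type*}
    [MeasurableSpace α] [MeasurableSpace β] {μ : Measure α} {ξ : Measure β} {R : α → β}
    (hR : MeasurePreserving R μ ξ) {H : β → ENNReal} (hH : Measurable H) :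
    (μ.withDensity (H ∘ R)).map R = ξ.withDensity H := by
  ext s hs
  rw [Measure.map_apply hR.measurable hs, withDensity_apply _ (hR.measurable hs),
    withDensity_apply _ hs]
  exact hR.setLIntegral_comp_preimage hs hH

end PiDensity

/-! ### The law of a processed tableau -/

section Law

variable {Y : YoungDiagram} {G : Type*} [AddCommGroup G]

/-- The sum of the environment, recovered from the diagonal sums of a processed tableau. -/
def total (Y : YoungDiagram) (f : ℕ → ℕ → G) : G :=
  ∑ i ∈ Finset.range (Y.colLen 0),
    (diagSum f (i + 1) (Y.rowLen i) - diagSum f i (Y.rowLen i))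

theorem sum_eq_sum_rows (x : Y → G) : ∑ c, x c
    = ∑ i ∈ Finset.range (Y.colLen 0), ∑ j ∈ Finset.range (Y.rowLen i),
      ext x (i + 1) (j + 1) := by
  have h1 : ∑ c, x c = ∑ p ∈ Y.cells, ext x (p.1 + 1) (p.2 + 1) := by
    simp_rw [← ext_cell x]
    exact (Finset.sum_subtype Y.cells (fun _ => Iff.rfl)
      fun p : ℕ × ℕ => ext x (p.1 + 1) (p.2 + 1)).symm
  rw [h1, Finset.sum_sigma']
  refine Finset.sum_bij' (fun p _ => ⟨p.1, p.2⟩) (fun p _ => (p.1, p.2)) ?_ ?_ ?_ ?_ ?_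
  · rintro ⟨i, j⟩ hp
    rw [YoungDiagram.mem_cells] at hp
    simp only [Finset.mem_sigma, Finset.mem_range]
    exact ⟨YoungDiagram.mem_iff_lt_colLen.1 (Y.up_left_mem le_rfl (Nat.zero_le _) hp),
      YoungDiagram.mem_iff_lt_rowLen.1 hp⟩
  · rintro ⟨i, j⟩ hp
    simp only [Finset.mem_sigma, Finset.mem_range] at hp
    exact YoungDiagram.mem_iff_lt_rowLen.2 hp.2
  · intros; rfl
  · intros; rfl
  · intros; rfl

theorem SumInv.total_eq {x : Y → G} {f : ℕ → ℕ → G} (h : SumInv Y (ext x) f) :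
    total Y f = ∑ c, x c := by
  rw [sum_eq_sum_rows]
  refine Finset.sum_congr rfl fun i hi => ?_
  -- The rectangles of `i` and of `i + 1` rows, both of width `Y.rowLen i`, end at the border and
  -- differ exactly by row `i` of the diagram.
  have hb : ∀ i, ∀ I, (I = i ∨ I = i + 1) → IsBorder Y I (Y.rowLen i) := by
    intro i I hI
    refine ⟨?_, fun hm => ?_⟩
    · rcases Nat.eq_zero_or_pos I with h0 | h0
      · exact Or.inl h0
      rcases Nat.eq_zero_or_pos (Y.rowLen i) with h1 | h1
      · exact Or.inr (Or.inl h1)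
      · have : (i, Y.rowLen i - 1) ∈ Y := YoungDiagram.mem_iff_lt_rowLen.2 (by omega)
        exact Or.inr (Or.inr (Y.up_left_mem (by omega) le_rfl this))
    · have h1 := YoungDiagram.mem_iff_lt_rowLen.1 hm
      have h2 := Y.rowLen_anti i I (by omega)
      omega
  rw [h.diagSum_eq _ _ (hb i _ (Or.inr rfl)), h.diagSum_eq _ _ (hb i _ (Or.inl rfl)), rectSum,
    rectSum, Finset.sum_range_succ]
  abel

theorem cone_bot_iff [LinearOrder G] (x : Y → G) : Cone ⊥ (ext x) ↔ ∀ c, 0 ≤ x c := by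
  refine ⟨fun h c => ?_, fun h => ⟨fun I J => ?_, fun i j hij => ?_, fun i j hij => ?_⟩⟩
  · rw [← ext_cell x]
    exact h.nonneg _ _
  · rcases I with _ | a
    · simp
    rcases J with _ | b
    · simp
    by_cases hm : (a, b) ∈ Y
    · rw [ext_mem _ hm]
      exact h _
    · rw [ext_of_notMem _ hm]
  · simp at hij
  · simp at hij

variable [MeasurableSpace G]

section Total

variable [MeasurableAdd₂ G]

theorem measurable_diagSum (I J : ℕ) : Measurable fun r : Y → G => diagSum (ext r) I J := by
  induction I generalizing J with
  | zero => simp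
  | succ I ih =>
    cases J with
    | zero => simp
    | succ J => exact (measurable_ext _ _).add (ih J)

theorem measurable_total [MeasurableSub₂ G] : Measurable fun r : Y → G => total Y (ext r) :=
  Finset.measurable_sum _ fun _ _ => (measurable_diagSum _ _).sub (measurable_diagSum _ _)

end Total

variable [LinearOrder G]

theorem measurableSet_cone (hle : MeasurableSet {p : G × G | p.1 ≤ p.2}) :
    MeasurableSet {r : Y → G | Cone Y (ext r)} := by
  have hle' : ∀ {f g : (Y → G) → G}, Measurable f → Measurable g →
      MeasurableSet {r | f r ≤ g r} := fun hf hg => (hf.prodMk hg) hle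
  have h : {r : Y → G | Cone Y (ext r)} = (⋂ I, ⋂ J, {r | 0 ≤ ext r I J}) ∩
      ((⋂ i, ⋂ j, ⋂ (_ : (i, j) ∈ Y), {r | ext r i (j + 1) ≤ ext r (i + 1) (j + 1)}) ∩
      (⋂ i, ⋂ j, ⋂ (_ : (i, j) ∈ Y), {r | ext r (i + 1) j ≤ ext r (i + 1) (j + 1)})) := by
    ext r
    simp only [Set.mem_inter_iff, Set.mem_iInter, Set.mem_ofPred_eq]
    exact ⟨fun h => ⟨h.nonneg, h.up, h.left⟩, fun h => ⟨h.1, h.2.1, h.2.2⟩⟩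
  rw [h]
  refine (MeasurableSet.iInter fun I => MeasurableSet.iInter fun J =>
    hle' (by fun_prop) (by fun_prop)).inter (MeasurableSet.inter ?_ ?_) <;>
  exact MeasurableSet.iInter fun i => MeasurableSet.iInter fun j => MeasurableSet.iInter fun _ =>
    hle' (by fun_prop) (by fun_prop)

variable [MeasurableAdd₂ G] [MeasurableSub₂ G] (ν : Measure G) [SigmaFinite ν]

open Classical in
/-- The law of a processed tableau depends only on how the cone and the sums are transformed. -/
theorem map_pi_eq {R : (Y → G) → Y → G}
    (hR : MeasurePreserving R (Measure.pi fun _ => ν) (Measure.pi fun _ => ν))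
    (hcone : ∀ x, Cone Y (ext (R x)) ↔ Cone ⊥ (ext x))
    (hsum : ∀ x, Cone ⊥ (ext x) → SumInv Y (ext x) (ext (R x)))
    (hle : MeasurableSet {p : G × G | p.1 ≤ p.2}) {w : Multiplicative G →* ENNReal}
    (hw : Measurable fun t => w (Multiplicative.ofAdd t)) (C : ENNReal)
    [SigmaFinite (ν.withDensity fun t => if 0 ≤ t then C * w (Multiplicative.ofAdd t) else 0)] :
    (Measure.pi fun _ : Y =>
      ν.withDensity fun t => if 0 ≤ t then C * w (Multiplicative.ofAdd t) else 0).map R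
    = (Measure.pi fun _ : Y => ν).withDensity fun r =>
      if Cone Y (ext r) then C ^ Fintype.card Y * w (Multiplicative.ofAdd (total Y (ext r)))
      else 0 := by
  have hpos : MeasurableSet {t : G | 0 ≤ t} :=
    (measurable_const.prodMk measurable_id : Measurable fun t : G => ((0 : G), t)) hle
  have hh : Measurable fun t => if 0 ≤ t then C * w (Multiplicative.ofAdd t) else 0 :=
    Measurable.ite hpos (measurable_const.mul hw) measurable_const
  -- The product density factors through `R`: `hcone` matches the supports, and on the support `w`
  -- turns the product into a function of the sum of the weights, which is `total` of the image.
  rw [pi_withDensity ν hh, ← hR.map_withDensity_comp (H := fun r : Y → G => if Cone Y (ext r) then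
      C ^ Fintype.card Y * w (Multiplicative.ofAdd (total Y (ext r))) else 0)
    (Measurable.ite (measurableSet_cone hle)
      (measurable_const.mul (hw.comp measurable_total)) measurable_const)]
  congr 2
  funext x
  simp only [Function.comp_apply, hcone]
  split_ifs with hx
  · rw [(hsum x hx).total_eq]
    rw [cone_bot_iff] at hx
    simp only [hx, if_true, Finset.prod_mul_distrib, Finset.prod_const, Finset.card_univ]
    rw [ofAdd_sum, map_prod]
  · rw [cone_bot_iff, not_forall] at hx
    obtain ⟨c, hc⟩ := hx
    exact Finset.prod_eq_zero (Finset.mem_univ c) (by simp [hc])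

end Law

/-! ### Recursions for last passage times -/

section Paths

variable {Y : YoungDiagram}

theorem latticeDist_self (p : ℕ × ℕ) : latticeDist p p = 0 := by simp [latticeDist]

theorem lppTime_self (x : Y → ℝ) (p : Y) : lppTime x p.1 p.1 = x p := by
  have h : pathWeights x p.1 p.1 = {x p} := by
    ext s
    constructor
    · rintro ⟨π, hπ, rfl⟩
      have hlen := hπ.minimal
      rw [latticeDist_self, zero_add, List.length_map, List.length_eq_one_iff] at hlen
      obtain ⟨c, rfl⟩ := hlen
      have hc := hπ.head
      simp only [List.map_cons, List.map_nil, List.head?_cons, Option.some.injEq] at hc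
      simp [Subtype.ext hc]
    · rintro rfl
      exact ⟨[p], ⟨by simp, by simp, by simp, by simp [latticeDist_self]⟩, by simp⟩
  rw [lppTime, h, csSup_singleton]

theorem mem_pathWeights_iff (x : Y → ℝ) {p : ℕ × ℕ} {q : Y} (hpq : p ≠ q.1) {s : ℝ} :
    s ∈ pathWeights x p q.1 ↔ ∃ q', (latticeDist q' q.1 = 1 ∧
      latticeDist p q' + 1 = latticeDist p q.1) ∧ ∃ t ∈ pathWeights x p q', s = t + x q := by
  constructor
  · rintro ⟨π, hπ, rfl⟩
    obtain ⟨h1, h2, h3, h4⟩ := hπ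
    rcases List.eq_nil_or_concat π with rfl | ⟨ρ, c, rfl⟩
    · simp at h1
    rw [List.concat_eq_append] at *
    rw [List.map_append, List.map_singleton, List.getLast?_concat, Option.some.injEq] at h2
    obtain rfl : c = q := Subtype.ext h2
    rcases List.eq_nil_or_concat ρ with rfl | ⟨σ, d, rfl⟩
    · simp only [List.nil_append, List.map_singleton, List.head?_cons, Option.some.injEq] at h1
      exact absurd h1.symm hpq
    rw [List.concat_eq_append] at *
    have hd : latticeDist d.1 c.1 = 1 := by
      rw [List.map_append, List.map_append, List.isChain_append] at h3
      exact h3.2.2 d.1 (by simp) c.1 (by simp)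
    have hl : (σ ++ [d]).length = latticeDist p c.1 := by
      simpa using h4
    rw [List.map_append (l₂ := [c]), List.head?_append_of_ne_nil _ (by simp)] at h1
    rw [List.map_append (l₂ := [c]), List.isChain_append] at h3
    -- The truncated path has too few steps for the distance to be larger, and the triangle
    -- inequality excludes a smaller one.
    have hpd : latticeDist p d.1 + 1 = latticeDist p c.1 := by
      obtain ⟨l, hpl⟩ := List.head?_eq_some_iff.1 h1
      have hch := h3.1
      have hlast : ((σ ++ [d]).map Subtype.val).getLast? = some d.1 := by simp
      rw [hpl] at hch hlast
      have hle := latticeDist_le_of_chain l p hch hlast p (by simp)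
      have hlen := congrArg List.length hpl
      rw [List.length_map, hl, List.length_cons] at hlen
      simp only [latticeDist] at *
      omega
    refine ⟨d.1, ⟨hd, hpd⟩, _, ⟨σ ++ [d], ⟨h1, by simp, h3.1, ?_⟩, rfl⟩, ?_⟩
    · rw [List.length_map, hl, hpd]
    · simp [add_assoc]
  · rintro ⟨q', ⟨hq, hpq'⟩, t, ⟨π, ⟨h1, h2, h3, h4⟩, rfl⟩, rfl⟩
    refine ⟨π ++ [q], ⟨?_, by simp, ?_, ?_⟩, by simp⟩
    · rw [List.map_append, List.head?_append, h1]
      rfl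
    · rw [List.map_append, List.isChain_append]
      refine ⟨h3, by simp, fun u hu v hv => ?_⟩
      rw [h2] at hu
      simp only [List.map_cons, List.map_nil, List.head?_cons, Option.mem_def,
        Option.some.injEq] at hu hv
      rw [← hu, ← hv]
      exact hq
    · rw [List.map_append, List.length_append, h4, hpq']
      simp

/-- The boxes `q₁` and `q₂` are the possible predecessors of `q`; they may coincide, which covers
boxes with a single predecessor. -/
theorem lppTime_step (x : Y → ℝ) {p q₁ q₂ : ℕ × ℕ} (q : Y) (hpq : p ≠ q.1)
    (h : ∀ q', (latticeDist q' q.1 = 1 ∧ latticeDist p q' + 1 = latticeDist p q.1)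
      ↔ q' = q₁ ∨ q' = q₂)
    (hY : (max p.1 q.1.1, max p.2 q.1.2) ∈ Y) (h₁ : (max p.1 q₁.1, max p.2 q₁.2) ∈ Y)
    (h₂ : (max p.1 q₂.1, max p.2 q₂.2) ∈ Y) :
    lppTime x p q.1 = max (lppTime x p q₁) (lppTime x p q₂) + x q := by
  refine (isGreatest_lppTime x p q.1 hY).unique ⟨?_, fun s hs => ?_⟩
  · rw [mem_pathWeights_iff x hpq]
    rcases max_choice (lppTime x p q₁) (lppTime x p q₂) with hm | hm
    · exact ⟨q₁, (h _).2 (Or.inl rfl), _, (isGreatest_lppTime x p q₁ h₁).1, by rw [hm]⟩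
    · exact ⟨q₂, (h _).2 (Or.inr rfl), _, (isGreatest_lppTime x p q₂ h₂).1, by rw [hm]⟩
  · rw [mem_pathWeights_iff x hpq] at hs
    obtain ⟨q', hq', t, ht, rfl⟩ := hs
    gcongr
    rcases (h q').1 hq' with rfl | rfl
    · exact ((isGreatest_lppTime x p _ h₁).2 ht).trans (le_max_left _ _)
    · exact ((isGreatest_lppTime x p _ h₂).2 ht).trans (le_max_right _ _)

theorem lppTime_nonneg {x : Y → ℝ} (hx : ∀ c, 0 ≤ x c) {p q : ℕ × ℕ}
    (hY : (max p.1 q.1, max p.2 q.2) ∈ Y) : 0 ≤ lppTime x p q := by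
  obtain ⟨π, -, h⟩ := (isGreatest_lppTime x p q hY).1
  rw [h]
  refine List.sum_nonneg fun t ht => ?_
  obtain ⟨c, -, rfl⟩ := List.mem_map.1 ht
  exact hx c

theorem lppTime_add_const (x : Y → ℝ) (k : ℝ) {p q : ℕ × ℕ}
    (hY : (max p.1 q.1, max p.2 q.2) ∈ Y) :
    lppTime (fun c => x c + k) p q = lppTime x p q + (latticeDist p q + 1) * k := by
  have hs : ∀ π : List Y, IsDirectedPath p q (π.map Subtype.val) →
      (π.map fun c => x c + k).sum = (π.map x).sum + (latticeDist p q + 1) * k := by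
    intro π hπ
    have hl := hπ.minimal
    rw [List.length_map] at hl
    rw [List.sum_map_add, List.map_const', List.sum_replicate, hl, nsmul_eq_mul]
    push_cast
    ring
  refine (isGreatest_lppTime _ p q hY).unique ⟨?_, ?_⟩
  · obtain ⟨π, hπ, h⟩ := (isGreatest_lppTime x p q hY).1
    exact ⟨π, hπ, by rw [hs π hπ, h]⟩
  · rintro _ ⟨π, hπ, rfl⟩
    rw [hs π hπ]
    gcongr
    exact (isGreatest_lppTime x p q hY).2 ⟨π, hπ, rfl⟩

theorem lppTableau_eq_lppRec {x : Y → ℝ} (hx : ∀ c, 0 ≤ x c) {i j : ℕ} (h : (i, j) ∈ Y) :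
    lppTime x (0, 0) (i, j) = lppRec (ext x) (i + 1) (j + 1) := by
  have hb : ∀ {i j}, (i, j) ∈ Y → (max 0 i, max 0 j) ∈ Y := fun h => by simpa using h
  induction i generalizing j with
  | zero =>
    induction j with
    | zero => simpa [lppRec_succ, ext_mem x h] using lppTime_self x ⟨(0, 0), h⟩
    | succ j ih =>
      have h' : (0, j) ∈ Y := Y.up_left_mem le_rfl (by omega) h
      rw [lppTime_step x (p := (0, 0)) ⟨_, h⟩ (q₁ := (0, j)) (q₂ := (0, j)) (by simp) ?_ (hb h) (hb h') (hb h'),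
        max_self, ih h', lppRec_succ _ 0 (j + 1), lppRec_zero_left, ext_mem x h, max_eq_right]
      · rw [← ih h']
        exact lppTime_nonneg hx (hb h')
      · rintro ⟨a, b⟩
        simp only [latticeDist, Prod.mk.injEq]
        omega
  | succ i ihi =>
    have hi : ∀ {j}, (i + 1, j) ∈ Y → (i, j) ∈ Y := fun h => Y.up_left_mem (by omega) le_rfl h
    induction j with
    | zero =>
      rw [lppTime_step x (p := (0, 0)) ⟨_, h⟩ (q₁ := (i, 0)) (q₂ := (i, 0)) (by simp) ?_ (hb h)
        (hb (hi h)) (hb (hi h)), max_self, ihi (hi h), lppRec_succ _ (i + 1) 0,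
        lppRec_zero_right, ext_mem x h, max_eq_left]
      · rw [← ihi (hi h)]
        exact lppTime_nonneg hx (hb (hi h))
      · rintro ⟨a, b⟩
        simp only [latticeDist, Prod.mk.injEq]
        omega
    | succ j ih =>
      have h' : (i + 1, j) ∈ Y := Y.up_left_mem le_rfl (by omega) h
      rw [lppTime_step x (p := (0, 0)) ⟨_, h⟩ (q₁ := (i, j + 1)) (q₂ := (i + 1, j)) (by simp) ?_ (hb h)
        (hb (hi h)) (hb h'), ihi (hi h), ih h', lppRec_succ _ (i + 1) (j + 1), ext_mem x h]
      rintro ⟨a, b⟩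
      simp only [latticeDist, Prod.mk.injEq]
      omega

/-- Going up from row `a + 1` to row `a` is one passage. In the first column `pass` compares with
the zero boundary, which is harmless because the weights are nonnegative. -/
theorem pass_eq_lppTime {x : Y → ℝ} (hx : ∀ c, 0 ≤ x c) {i a : ℕ} (ha : a < i) {g : ℕ → ℝ}
    (hg : ∀ j, (i, j) ∈ Y → g (j + 1) = lppTime x (i, 0) (a + 1, j)) {j : ℕ}
    (h : (i, j) ∈ Y) :
    pass (cumRow (ext x) a) g (j + 1) = lppTime x (i, 0) (a, j) := by
  have hb : ∀ {a j}, a ≤ i → (i, j) ∈ Y → (max i a, max 0 j) ∈ Y := fun ha h => by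
    simpa [ha] using h
  have hc : ∀ j, cumRow (ext x) a (j + 1) - cumRow (ext x) a j = ext x (a + 1) (j + 1) := by
    intro j
    rw [cumRow, cumRow, Finset.sum_range_succ, add_sub_cancel_left]
  have hY : ∀ {j}, (i, j) ∈ Y → (a, j) ∈ Y := fun h => Y.up_left_mem ha.le le_rfl h
  induction j with
  | zero =>
    rw [lppTime_step x ⟨_, hY h⟩ (q₁ := (a + 1, 0)) (q₂ := (a + 1, 0)) (by simp; omega) ?_
      (hb ha.le h) (hb ha h) (hb ha h), max_self, pass_succ, pass_zero, hg 0 h, hc,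
      ext_mem x (hY h), max_eq_right (lppTime_nonneg hx (hb ha h))]
    rintro ⟨c, d⟩
    simp only [latticeDist, Prod.mk.injEq]
    omega
  | succ j ih =>
    have h' : (i, j) ∈ Y := Y.up_left_mem le_rfl (by omega) h
    rw [lppTime_step x ⟨_, hY h⟩ (q₁ := (a, j)) (q₂ := (a + 1, j + 1)) (by simp) ?_
      (hb ha.le h) (hb ha.le h') (hb ha h), pass_succ, ih h', hg _ h, hc, ext_mem x (hY h)]
    rintro ⟨c, d⟩
    simp only [latticeDist, Prod.mk.injEq]
    omega

theorem cumRow_eq_lppTime (x : Y → ℝ) {i j : ℕ} (h : (i, j) ∈ Y) :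
    cumRow (ext x) i (j + 1) = lppTime x (i, 0) (i, j) := by
  have hb : ∀ {j}, (i, j) ∈ Y → (max i i, max 0 j) ∈ Y := fun h => by simpa using h
  induction j with
  | zero => simpa [cumRow, ext_mem x h] using (lppTime_self x ⟨(i, 0), h⟩).symm
  | succ j ih =>
    have h' : (i, j) ∈ Y := Y.up_left_mem le_rfl (by omega) h
    rw [lppTime_step x ⟨_, h⟩ (q₁ := (i, j)) (q₂ := (i, j)) (by simp) ?_ (hb h) (hb h') (hb h'),
      max_self, ← ih h', cumRow, Finset.sum_range_succ, ← ext_mem x h]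
    · rfl
    rintro ⟨c, d⟩
    simp only [latticeDist, Prod.mk.injEq]
    omega

theorem dualTableau_eq_lines {x : Y → ℝ} (hx : ∀ c, 0 ≤ x c) {i j : ℕ} (h : (i, j) ∈ Y) :
    lppTime x (i, 0) (0, j) = lines (cumRow (ext x)) (i + 1) i (j + 1) := by
  rw [lines_top fun i => by simp [cumRow]]
  have H : ∀ a ≤ i, ∀ g : ℕ → ℝ, (∀ j, (i, j) ∈ Y → g (j + 1) = lppTime x (i, 0) (a, j)) →
      passDown (cumRow (ext x)) a g (j + 1) = lppTime x (i, 0) (0, j) := by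
    intro a
    induction a with
    | zero => exact fun _ g hg => hg j h
    | succ a ih =>
      exact fun ha g hg => ih (by omega) _ fun j hj => pass_eq_lppTime hx ha hg hj
  exact (H i le_rfl _ fun j hj => cumRow_eq_lppTime x hj).symm

end Paths

/-! ### Transport along a monotone homomorphism to ℝ -/

section Map

variable {G : Type*} [AddCommGroup G] {φ : G →+ ℝ}

theorem map_ext {Y : YoungDiagram} (x : Y → G) :
    (fun i j => φ (ext x i j)) = ext fun c => φ (x c) := by
  funext i j
  rcases i with _ | a
  · simp
  rcases j with _ | b
  · simp
  by_cases h : (a, b) ∈ Y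
  · rw [ext_mem _ h, ext_mem _ h]
  · rw [ext_of_notMem _ h, ext_of_notMem _ h, map_zero]

variable [LinearOrder G]

theorem map_lppRec (hφ : Monotone φ) (X : ℕ → ℕ → G) (I J : ℕ) :
    φ (lppRec X I J) = lppRec (fun i j => φ (X i j)) I J := by
  induction I generalizing J with
  | zero => simp
  | succ I ihI =>
    induction J with
    | zero => simp
    | succ J ih => rw [lppRec_succ, lppRec_succ, map_add, hφ.map_max, ihI, ih]

theorem map_pass (hφ : Monotone φ) (z g : ℕ → G) :
    (fun j => φ (pass z g j)) = pass (fun j => φ (z j)) fun j => φ (g j) := by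
  funext j
  induction j with
  | zero => simp
  | succ j ih => rw [pass_succ, pass_succ, map_add, hφ.map_max, ih, map_sub]

theorem map_passDown (hφ : Monotone φ) (V : ℕ → ℕ → G) (m : ℕ) (g : ℕ → G) :
    (fun j => φ (passDown V m g j)) = passDown (fun i j => φ (V i j)) m fun j => φ (g j) := by
  induction m generalizing g with
  | zero => rfl
  | succ m ih => rw [passDown, ih, map_pass hφ]; rfl

theorem map_lines_top [IsOrderedAddMonoid G] (hφ : Monotone φ) (X : ℕ → ℕ → G) (m J : ℕ) :
    φ (lines (cumRow X) (m + 1) m J) = lines (cumRow fun i j => φ (X i j)) (m + 1) m J := by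
  have hc : (fun i j => φ (cumRow X i j)) = cumRow fun i j => φ (X i j) := by
    funext i j
    simp [cumRow]
  rw [lines_top fun i => by simp [cumRow], lines_top fun i => by simp [cumRow], ← hc]
  exact congrFun (map_passDown hφ (cumRow X) m (cumRow X m)) J

end Map

/-! ### Measurability, shifts and corners -/

section Measurability

variable {Y : YoungDiagram}

theorem measurable_lppTime {p q : ℕ × ℕ} (hY : (max p.1 q.1, max p.2 q.2) ∈ Y) :
    Measurable fun x : Y → ℝ => lppTime x p q := by
  have hfin : {π : List Y | IsDirectedPath p q (π.map Subtype.val)}.Finite :=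
    (List.finite_length_eq Y (latticeDist p q + 1)).subset fun π hπ => by
      simpa using hπ.minimal
  have hne : hfin.toFinset.Nonempty := by
    obtain ⟨π, hπ, -⟩ := (isGreatest_lppTime (0 : Y → ℝ) p q hY).1
    exact ⟨π, hfin.mem_toFinset.2 hπ⟩
  have h : (fun x : Y → ℝ => lppTime x p q)
      = hfin.toFinset.sup' hne fun π x => (π.map x).sum := by
    funext x
    rw [Finset.sup'_apply]
    refine (isGreatest_lppTime x p q hY).unique ⟨?_, ?_⟩
    · obtain ⟨π, hπ, h⟩ := Finset.exists_mem_eq_sup' hne fun π : List Y => (π.map x).sum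
      exact ⟨π, hfin.mem_toFinset.1 hπ, h⟩
    · rintro _ ⟨π, hπ, rfl⟩
      exact Finset.le_sup' (fun π : List Y => (π.map x).sum) (hfin.mem_toFinset.2 hπ)
  rw [h]
  have hπ : ∀ π : List Y, Measurable fun x : Y → ℝ => (π.map x).sum := fun π => by
    induction π with
    | nil => simp
    | cons c π ih =>
      simp only [List.map_cons, List.sum_cons]
      exact (measurable_pi_apply c).add ih
  exact Finset.measurable_sup' hne fun π _ => hπ π

theorem measurable_lppTableau (c : Y) : Measurable fun x : Y → ℝ => lppTableau x c :=
  measurable_lppTime (by simp)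

theorem measurable_dualTableau (c : Y) : Measurable fun x : Y → ℝ => dualTableau x c :=
  measurable_lppTime (by simp)

theorem lppTableau_add_const (x : Y → ℝ) (k : ℝ) (c : Y) :
    lppTableau (fun b => x b + k) c = lppTableau x c + (c.1.1 + c.1.2 + 1) * k := by
  rw [lppTableau, lppTime_add_const _ _ (by simp), lppTableau]
  simp [latticeDist]

theorem dualTableau_add_const (x : Y → ℝ) (k : ℝ) (c : Y) :
    dualTableau (fun b => x b + k) c = dualTableau x c + (c.1.1 + c.1.2 + 1) * k := by
  rw [dualTableau, lppTime_add_const _ _ (by simp), dualTableau]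
  simp [latticeDist]

theorem corners_subset_borderStrip : corners Y ⊆ borderStrip Y := by
  intro c hc hm
  have h1 : (c.1.1 + 1, c.1.2 + 1) ∈ (Y : Set (ℕ × ℕ)) \ {c.1} := by
    refine ⟨hm, fun h => ?_⟩
    have := congrArg Prod.fst (Set.mem_singleton_iff.1 h)
    dsimp only at this
    omega
  exact (hc (Prod.mk_le_mk.2 ⟨Nat.le_succ _, Nat.le_succ _⟩ : c.1 ≤ _) h1).2 rfl

end Measurability

/-! ### Equality of the joint laws -/

section Main

variable {Y : YoungDiagram} {G : Type*} [AddCommGroup G] [LinearOrder G] [IsOrderedAddMonoid G]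
  [MeasurableSpace G] [MeasurableAdd₂ G] [MeasurableSub₂ G] [MeasurableNeg G] [MeasurableInf₂ G]
  [MeasurableSup₂ G] (ν : Measure G) [SigmaFinite ν] [ν.IsAddLeftInvariant] [ν.IsNegInvariant]

/-- The measure on `G` with density `A * exp (r * φ t)` on `t ≥ 0`. -/
noncomputable def expLaw (φ : G →+ ℝ) (A r : ℝ) : Measure G :=
  ν.withDensity fun t =>
    if 0 ≤ t then ENNReal.ofReal A * ENNReal.ofReal (Real.exp (r * φ t)) else 0

/-- The exponential weight `exp (r * φ t)` as a multiplicative function. -/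
noncomputable def expWeight (φ : G →+ ℝ) (r : ℝ) : Multiplicative G →* ENNReal where
  toFun t := ENNReal.ofReal (Real.exp (r * φ t.toAdd))
  map_one' := by simp
  map_mul' s t := by
    rw [← ENNReal.ofReal_mul (Real.exp_pos _).le, ← Real.exp_add, toAdd_mul, map_add, mul_add]

theorem map_lppTableau_eq_map_dualTableau {φ : G →+ ℝ} (hφ : Monotone φ) (hφm : Measurable φ)
    (hle : MeasurableSet {p : G × G | p.1 ≤ p.2}) {A r : ℝ} [SigmaFinite (expLaw ν φ A r)] :
    (Measure.pi fun _ : Y => expLaw ν φ A r).map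
      (fun g (c : borderStrip Y) => lppTableau (fun b => φ (g b)) c.1)
    = (Measure.pi fun _ : Y => expLaw ν φ A r).map
      (fun g (c : borderStrip Y) => dualTableau (fun b => φ (g b)) c.1) := by
  classical
  obtain ⟨R, hR, hR'⟩ := exists_rsk Y ν
  obtain ⟨B, hB, hB'⟩ := exists_burge Y ν
  have hw : Measurable fun t => expWeight φ r (Multiplicative.ofAdd t) :=
    (Real.measurable_exp.comp (hφm.const_mul r)).ennreal_ofReal
  have hpos : MeasurableSet {t : G | 0 ≤ t} :=
    (measurable_const.prodMk measurable_id : Measurable fun t : G => ((0 : G), t)) hle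
  have hae : ∀ᵐ g ∂(Measure.pi fun _ : Y => expLaw ν φ A r), ∀ c, 0 ≤ g c := by
    refine Filter.eventually_all.2 fun c => Measure.tendsto_eval_ae_ae.eventually ?_
    have hh : Measurable fun t => if 0 ≤ t then
        ENNReal.ofReal A * ENNReal.ofReal (Real.exp (r * φ t)) else 0 :=
      Measurable.ite hpos (measurable_const.mul hw) measurable_const
    rw [expLaw, ae_withDensity_iff hh]
    exact Filter.Eventually.of_forall fun t ht => by
      by_contra h
      simp [h] at ht
  -- The right-hand side of `map_pi_eq` does not involve the map, so RSK and Burge give the same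
  -- law.
  have hlaw : (Measure.pi fun _ : Y => expLaw ν φ A r).map R
      = (Measure.pi fun _ : Y => expLaw ν φ A r).map B := by
    have : SigmaFinite (ν.withDensity fun t => if 0 ≤ t then
        ENNReal.ofReal A * expWeight φ r (Multiplicative.ofAdd t) else 0) :=
      ‹SigmaFinite (expLaw ν φ A r)›
    have h1 := map_pi_eq ν hR (fun x => (hR' x).1) (fun x hx => ((hR' x).2 hx).1) hle hw
      (ENNReal.ofReal A)
    have h2 := map_pi_eq ν hB (fun x => (hB' x).1) (fun x hx => ((hB' x).2 hx).1) hle hw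
      (ENNReal.ofReal A)
    exact h1.trans h2.symm
  have hF : Measurable fun (y : Y → G) (c : borderStrip Y) => φ (y c.1) :=
    measurable_pi_lambda _ fun c => hφm.comp (measurable_pi_apply c.1)
  have hφ0 : ∀ {t}, 0 ≤ t → 0 ≤ φ t := fun h => by simpa using hφ h
  have hb : ∀ c ∈ borderStrip Y, IsBorder Y (c.1.1 + 1) (c.1.2 + 1) := fun c hc =>
    ⟨Or.inr (Or.inr c.2), hc⟩
  have hL : (fun g (c : borderStrip Y) => lppTableau (fun b => φ (g b)) c.1)
      =ᵐ[Measure.pi fun _ : Y => expLaw ν φ A r] fun g c => φ (R g c.1) := by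
    filter_upwards [hae] with g hg
    funext c
    have h := ((hR' g).2 ((cone_bot_iff g).2 hg)).2 _ _ (hb c.1 c.2)
    rw [ext_cell] at h
    rw [h, map_lppRec hφ, map_ext]
    exact lppTableau_eq_lppRec (fun b => hφ0 (hg b)) c.1.2
  have hD : (fun g (c : borderStrip Y) => dualTableau (fun b => φ (g b)) c.1)
      =ᵐ[Measure.pi fun _ : Y => expLaw ν φ A r] fun g c => φ (B g c.1) := by
    filter_upwards [hae] with g hg
    funext c
    have h := ((hB' g).2 ((cone_bot_iff g).2 hg)).2 _ _ (hb c.1 c.2) c.1.1.1 c.1.1.2 0 rfl rfl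
    rw [ext_cell] at h
    rw [h, map_lines_top hφ, map_ext]
    exact dualTableau_eq_lines (fun b => hφ0 (hg b)) c.1.2
  rw [Measure.map_congr hL, Measure.map_congr hD]
  have h1 := Measure.map_map (μ := Measure.pi fun _ : Y => expLaw ν φ A r) hF hR.measurable
  have h2 := Measure.map_map (μ := Measure.pi fun _ : Y => expLaw ν φ A r) hF hB.measurable
  exact h1.symm.trans ((congrArg _ hlaw).trans h2)

theorem identDistrib_borderStrip {Ω : Type*} [MeasurableSpace Ω] {P : Measure Ω}
    [IsProbabilityMeasure P] {X : Y → Ω → ℝ} (hindep : iIndepFun X P) {φ : G →+ ℝ}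
    (hφ : Monotone φ) (hφm : Measurable φ) (hle : MeasurableSet {p : G × G | p.1 ≤ p.2})
    {A r k : ℝ} [IsProbabilityMeasure (expLaw ν φ A r)]
    (hlaw : ∀ c, HasLaw (X c) ((expLaw ν φ A r).map fun t => φ t + k) P) :
    IdentDistrib (fun ω (c : borderStrip Y) => lppTableau (fun b => X b ω) c.1)
      (fun ω (c : borderStrip Y) => dualTableau (fun b => X b ω) c.1) P P := by
  have hX : AEMeasurable (fun ω b => X b ω) P := aemeasurable_pi_lambda _ fun c =>
    (hlaw c).aemeasurable
  have hL : Measurable fun (x : Y → ℝ) (c : borderStrip Y) => lppTableau x c.1 :=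
    measurable_pi_lambda _ fun c => measurable_lppTableau c.1
  have hD : Measurable fun (x : Y → ℝ) (c : borderStrip Y) => dualTableau x c.1 :=
    measurable_pi_lambda _ fun c => measurable_dualTableau c.1
  have hs : Measurable fun t => φ t + k := hφm.add_const k
  have hS : Measurable fun (g : Y → G) c => φ (g c) + k :=
    measurable_pi_lambda _ fun c => hs.comp (measurable_pi_apply c)
  have hP : Measurable fun (g : Y → G) c => φ (g c) :=
    measurable_pi_lambda _ fun c => hφm.comp (measurable_pi_apply c)
  have hT : Measurable fun (v : borderStrip Y → ℝ) (c : borderStrip Y) =>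
      v c + (c.1.1.1 + c.1.1.2 + 1) * k :=
    measurable_pi_lambda _ fun c => (measurable_pi_apply c).add_const _
  have hXlaw : P.map (fun ω b => X b ω)
      = (Measure.pi fun _ : Y => expLaw ν φ A r).map fun g c => φ (g c) + k := by
    rw [(iIndepFun_iff_map_fun_eq_pi_map fun c => (hlaw c).aemeasurable).1 hindep]
    have := fun _ : Y => Measure.isProbabilityMeasure_map (μ := expLaw ν φ A r) hs.aemeasurable
    rw [Measure.pi_map_pi fun _ => hs.aemeasurable]
    exact congrArg _ (funext fun c => (hlaw c).map_eq)
  refine ⟨hL.comp_aemeasurable hX, hD.comp_aemeasurable hX, ?_⟩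
  have h1 := AEMeasurable.map_map_of_aemeasurable hL.aemeasurable hX
  have h2 := AEMeasurable.map_map_of_aemeasurable hD.aemeasurable hX
  refine h1.symm.trans (Eq.trans ?_ h2)
  rw [hXlaw, Measure.map_map hL hS, Measure.map_map hD hS]
  -- Shifting all weights by `k` adds the same deterministic vector to both tableaux, so it can be
  -- moved outside.
  have e1 : (fun (x : Y → ℝ) (c : borderStrip Y) => lppTableau x c.1) ∘
      (fun (g : Y → G) c => φ (g c) + k) = (fun (v : borderStrip Y → ℝ) (c : borderStrip Y) =>
      v c + (c.1.1.1 + c.1.1.2 + 1) * k) ∘ fun g c => lppTableau (fun b => φ (g b)) c.1 := by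
    funext g c
    exact lppTableau_add_const (fun b => φ (g b)) k c.1
  have e2 : (fun (x : Y → ℝ) (c : borderStrip Y) => dualTableau x c.1) ∘
      (fun (g : Y → G) c => φ (g c) + k) = (fun (v : borderStrip Y → ℝ) (c : borderStrip Y) =>
      v c + (c.1.1.1 + c.1.1.2 + 1) * k) ∘ fun g c => dualTableau (fun b => φ (g b)) c.1 := by
    funext g c
    exact dualTableau_add_const (fun b => φ (g b)) k c.1
  have h3 := Measure.map_map (μ := Measure.pi fun _ : Y => expLaw ν φ A r) hT (hL.comp hP)
  have h4 := Measure.map_map (μ := Measure.pi fun _ : Y => expLaw ν φ A r) hT (hD.comp hP)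
  rw [e1, e2]
  exact h3.symm.trans ((congrArg _ (map_lppTableau_eq_map_dualTableau ν hφ hφm hle)).trans h4)

end Main

/-! ### Exponential and geometric laws as exponential densities -/

section Laws

theorem expLaw_eq_expMeasure (α : ℝ) (hα : 0 < α) :
    expLaw volume (AddMonoidHom.id ℝ) α (-α) = expMeasure α := by
  have h : expMeasure α = volume.withDensity (exponentialPDF α) := rfl
  rw [h, expLaw]
  congr 1
  funext t
  rw [exponentialPDF_eq]
  split_ifs with h
  · rw [← ENNReal.ofReal_mul hα.le]
    simp
  · simp

theorem expLaw_eq_geometricMeasure {p : unitInterval} (h0 : 0 < p) (h1 : p < 1) :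
    expLaw Measure.count (Int.castAddHom ℝ) p (Real.log (1 - p))
      = (geometricMeasure p).map fun n : ℕ => (n : ℤ) := by
  have hp : (0 : ℝ) < 1 - p := sub_pos.2 h1
  refine Measure.ext_of_singleton fun m => ?_
  rw [expLaw, withDensity_apply _ (measurableSet_singleton m), lintegral_singleton,
    Measure.count_singleton, mul_one, Measure.map_apply (by fun_prop) (measurableSet_singleton m)]
  split_ifs with h
  · lift m to ℕ using h
    have hpre : (fun n : ℕ => (n : ℤ)) ⁻¹' {(m : ℤ)} = {m} := by
      ext n
      simp
    rw [hpre, geometricMeasure_singleton h0.ne', ← ENNReal.ofReal_mul p.2.1, mul_comm (p : ℝ)]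
    simp [mul_comm (Real.log _), Real.exp_nat_mul, Real.exp_log hp]
  · have hpre : (fun n : ℕ => (n : ℤ)) ⁻¹' {m} = ∅ := by
      ext n
      simp only [Set.mem_preimage, Set.mem_singleton_iff, Set.mem_empty_iff_false, iff_false]
      omega
    rw [hpre, measure_empty]

theorem geometricLaw_eq_map (k : ℕ) {p : unitInterval} (h0 : 0 < p) (h1 : p < 1) :
    geometricLaw k p = (expLaw Measure.count (Int.castAddHom ℝ) p (Real.log (1 - p))).map
      fun t => Int.castAddHom ℝ t + k := by
  rw [expLaw_eq_geometricMeasure h0 h1, Measure.map_map (by fun_prop) (by fun_prop), geometricLaw]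
  congr 1
  funext n
  simp

end Laws

end LPP

theorem theorem2p2 {Ω : Type*} [MeasurableSpace Ω] (P : Measure Ω) [IsProbabilityMeasure P]
    (Y : YoungDiagram) (X : Y → Ω → ℝ) (hindep : iIndepFun X P)
    (hlaw :
      (∃ (k : ℕ) (p : unitInterval), 0 < p ∧ p < 1 ∧
        ∀ c : Y, HasLaw (X c) (LPP.geometricLaw k p) P) ∨
      (∃ α : ℝ, 0 < α ∧ ∀ c : Y, HasLaw (X c) (expMeasure α) P)) :
    IdentDistrib
      (fun ω (c : LPP.borderStrip Y) => LPP.lppTableau (fun b => X b ω) c.1)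
      (fun ω (c : LPP.borderStrip Y) => LPP.dualTableau (fun b => X b ω) c.1) P P ∧
    IdentDistrib
      (fun ω (c : LPP.corners Y) => LPP.lppTableau (fun b => X b ω) c.1)
      (fun ω (c : LPP.corners Y) => LPP.dualTableau (fun b => X b ω) c.1) P P := by
  have hborder : IdentDistrib
      (fun ω (c : LPP.borderStrip Y) => LPP.lppTableau (fun b => X b ω) c.1)
      (fun ω (c : LPP.borderStrip Y) => LPP.dualTableau (fun b => X b ω) c.1) P P := by
    rcases hlaw with ⟨k, p, h0, h1, hlaw⟩ | ⟨α, hα, hlaw⟩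
    · have : IsProbabilityMeasure
          (LPP.expLaw Measure.count (Int.castAddHom ℝ) p (Real.log (1 - p))) := by
        rw [LPP.expLaw_eq_geometricMeasure h0 h1]
        exact Measure.isProbabilityMeasure_map (by fun_prop)
      refine LPP.identDistrib_borderStrip Measure.count hindep (φ := Int.castAddHom ℝ)
        (fun a b h => Int.cast_le.2 h) (measurable_of_countable _) measurableSet_le'
        (A := p) (r := Real.log (1 - p)) (k := k) fun c => ?_
      rw [← LPP.geometricLaw_eq_map k h0 h1]
      exact hlaw c
    · have : IsProbabilityMeasure (LPP.expLaw volume (AddMonoidHom.id ℝ) α (-α)) := by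
        rw [LPP.expLaw_eq_expMeasure α hα]
        exact isProbabilityMeasure_expMeasure hα
      refine LPP.identDistrib_borderStrip volume hindep (φ := AddMonoidHom.id ℝ)
        (fun a b h => h) measurable_id measurableSet_le' (A := α) (r := -α) (k := 0) fun c => ?_
      have hid : (fun t => AddMonoidHom.id ℝ t + 0) = id := by
        funext t
        simp
      rw [hid, Measure.map_id, LPP.expLaw_eq_expMeasure α hα]
      exact hlaw c
  exact ⟨hborder, hborder.comp (u := fun v (c : LPP.corners Y) =>
    v ⟨c.1, LPP.corners_subset_borderStrip c.2⟩)
    (measurable_pi_lambda _ fun c => measurable_pi_apply _)⟩
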